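/- Let $F$ be a field of characteristic $2$. All quadratic forms are finite-dimensional; $[1,b]$ is the form $x^2+xy+by^2$, and for $a_1,\dots,a_{n-1}\in F^\times$, $b\in F$ the form $\langle\langle a_1,\dots,a_{n-1},b]]=\langle 1,a_1\rangle\otimes\cdots\otimes\langle 1,a_{n-1}\rangle\otimes[1,b]$ is called a quadratic $n$-fold Pfister form. Let $I_qF$ be the Witt group of nonsingular quadratic forms over $F$, and $I_q^nF$ its subgroup generated by the Witt classes of scalar multiples of quadratic $n$-fold Pfister forms. For $a\in F$, $b\in F^\times$ the quaternion algebra $[a,b)=F\langle x,y: x^2+x=a,\ y^2=b,\ yxy^{-1}=x+1\rangle$ is identified with its norm form, which is isometric to $\langle\langle b,a]]$. A finite set $S$ of quadratic $n$-fold Pfister forms is *tight* if every element of the subgroup $G$ of $I_q^nF/I_q^{n+1}F$ generated by the classes of the forms in $S$ is represented by a quadratic $n$-fold Pfister form. In this case $\Sigma_S$ is the Witt class of the orthogonal sum of the quadratic $n$-fold Pfister forms representing the elements of $G$, for any choice of these representatives. For a finite family $(\varphi_i)_{i\in I}$ of such forms whose set of members is tight, let $\widetilde\Sigma$ be the Witt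 class of $\perp_{T\subseteq I}\pi_T$, where $\pi_T$ is a quadratic $n$-fold Pfister form representing $\sum_{i\in T}\varphi_i$ in $I_q^nF/I_q^{n+1}F$, for any choice of the $\pi_T$; if $G$ has order $2^{|I|}$, this is $\Sigma_S$ for $S=\{\varphi_i\}$. Let $\alpha\in F$ and $\beta,\gamma\in F^\times$ with $\beta\ne\alpha^2$. Then the quaternion algebras $$\psi=[\beta+\alpha^4\beta^{-1},\gamma),\qquad \phi=[\beta+\alpha^4\beta^{-1},\gamma(\alpha^2+\beta)),\qquad \pi=[\alpha^2+\beta,\gamma)$$ form a tight triplet, that is, $S=\{\psi,\phi,\pi\}$ is tight. If the subgroup $G$ of $I_q^2F/I_q^3F$ generated by $S$ has order $8$, then $\Sigma_S$ is the Witt class of $\langle\langle\gamma,\beta,\alpha]]$. Without this assumption, the invariant $\widetilde\Sigma$ of the family $(\psi,\phi,\pi)$ is always the Witt class of $\langle\langle\gamma,\beta,\alpha]]$. -/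

import Mathlib

universe u

/-- A nonsingular quadratic form over `F`: a finite-dimensional `F`-vector space with a
quadratic form whose polar form is nondegenerate. -/
structure NonsingularForm (F : Type u) [Field F] where
  /-- The underlying vector space. -/
  carrier : Type u
  [addCommGroup : AddCommGroup carrier]
  [module : Module F carrier]
  [finiteDimensional : FiniteDimensional F carrier]
  /-- The quadratic form. -/
  form : QuadraticForm F carrier
  nonsingular : ∀ v, (∀ w, QuadraticMap.polar form v w = 0) → v = 0

namespace NonsingularForm

attribute [instance] addCommGroup module finiteDimensional

variable {F : Type u} [Field F]

/-- Isometry of quadratic forms. -/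
def Isometric (p q : NonsingularForm F) : Prop :=
  Nonempty (p.form.IsometryEquiv q.form)

theorem Isometric.refl (p : NonsingularForm F) : Isometric p p :=
  ⟨QuadraticMap.IsometryEquiv.refl _⟩

theorem Isometric.symm {p q : NonsingularForm F} (h : Isometric p q) : Isometric q p :=
  h.map QuadraticMap.IsometryEquiv.symm

theorem Isometric.trans {p q r : NonsingularForm F} (h : Isometric p q) (h' : Isometric q r) :
    Isometric p r :=
  ⟨h.some.trans h'.some⟩

/-- The orthogonal sum `p ⊥ q`. -/
def orth (p q : NonsingularForm F) : NonsingularForm F where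
  carrier := p.carrier × q.carrier
  form := p.form.prod q.form
  nonsingular := by
    rintro ⟨v, w⟩ h
    refine Prod.ext (p.nonsingular v fun x => ?_) (q.nonsingular w fun x => ?_)
    · simpa [QuadraticMap.polar] using h (x, 0)
    · simpa [QuadraticMap.polar] using h (0, x)

/-- The scalar multiple `c q`, for `c ≠ 0`. -/
def scale (c : Fˣ) (q : NonsingularForm F) : NonsingularForm F where
  carrier := q.carrier
  form := (c : F) • q.form
  nonsingular := by
    intro v h
    refine q.nonsingular v fun w => ?_
    have := h w
    rw [FunLike.coe_smul, QuadraticMap.polar_smul] at this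
    simpa using this

/-- The form of dimension zero. -/
def zeroForm (F : Type u) [Field F] : NonsingularForm F where
  carrier := PUnit
  form := 0
  nonsingular := fun _ _ => rfl

/-- The two-dimensional quadratic form `a x² + x y + b y²` on `F × F`. -/
def binaryForm (a b : F) : QuadraticForm F (F × F) :=
  LinearMap.BilinMap.toQuadraticMap (LinearMap.mk₂ F (fun v w : F × F => a * v.1 * w.1 + v.1 * w.2 + b * v.2 * w.2)
    (fun _ _ _ => by simp; ring) (fun _ _ _ => by simp; ring)
    (fun _ _ _ => by simp; ring) (fun _ _ _ => by simp; ring))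

theorem binaryForm_apply (a b : F) (v : F × F) :
    binaryForm a b v = a * v.1 ^ 2 + v.1 * v.2 + b * v.2 ^ 2 := by
  simp [binaryForm]
  ring

/-- The hyperbolic plane `[0, 0]`. -/
def hyperbolicPlane (F : Type u) [Field F] : NonsingularForm F where
  carrier := F × F
  form := binaryForm 0 0
  nonsingular := by
    rintro ⟨x, y⟩ h
    have h1 := h (0, 1)
    have h2 := h (1, 0)
    simp only [QuadraticMap.polar, binaryForm_apply, Prod.mk_add_mk] at h1 h2
    have hx : x = 0 := by linear_combination h1
    have hy : y = 0 := by linear_combination h2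
    rw [hx, hy]; rfl

/-- The hyperbolic form: the orthogonal sum of `m` hyperbolic planes. -/
def hyperbolic (F : Type u) [Field F] : ℕ → NonsingularForm F
  | 0 => zeroForm F
  | m + 1 => orth (hyperbolicPlane F) (hyperbolic F m)

theorem orth_congr {p p' q q' : NonsingularForm F} (h : Isometric p p') (h' : Isometric q q') :
    Isometric (orth p q) (orth p' q') :=
  ⟨QuadraticMap.IsometryEquiv.prod h.some h'.some⟩

theorem orth_comm (p q : NonsingularForm F) : Isometric (orth p q) (orth q p) :=
  ⟨QuadraticMap.IsometryEquiv.prodComm _ _⟩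

theorem orth_assoc (p q r : NonsingularForm F) :
    Isometric (orth (orth p q) r) (orth p (orth q r)) :=
  ⟨⟨LinearEquiv.prodAssoc F p.carrier q.carrier r.carrier, fun v =>
    (add_assoc (p.form v.1.1) (q.form v.1.2) (r.form v.2)).symm⟩⟩

theorem zero_orth (p : NonsingularForm F) : Isometric (orth (zeroForm F) p) p := by
  exact ⟨⟨(LinearEquiv.uniqueProd : (PUnit.{u + 1} × p.carrier) ≃ₗ[F] p.carrier), fun v =>
    (zero_add (p.form v.2)).symm⟩⟩

theorem hyperbolic_add (m n : ℕ) :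
    Isometric (orth (hyperbolic F m) (hyperbolic F n)) (hyperbolic F (m + n)) := by
  induction m with
  | zero => simpa [hyperbolic] using zero_orth (hyperbolic F n)
  | succ m ih =>
    rw [Nat.succ_add]
    exact (orth_assoc _ _ _).trans (orth_congr (Isometric.refl _) ih)

theorem orth_orth_orth_comm (p q r s : NonsingularForm F) :
    Isometric (orth (orth p q) (orth r s)) (orth (orth p r) (orth q s)) :=
  ⟨QuadraticMap.IsometryEquiv.prodProdProdComm _ _ _ _⟩

/-- Witt equivalence: `p` and `q` become isometric after adding hyperbolic planes. -/
def WittEquivalent (p q : NonsingularForm F) : Prop :=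
  ∃ m n : ℕ, Isometric (orth p (hyperbolic F m)) (orth q (hyperbolic F n))

theorem Isometric.wittEquivalent {p q : NonsingularForm F} (h : Isometric p q) :
    WittEquivalent p q :=
  ⟨0, 0, orth_congr h (Isometric.refl _)⟩

theorem WittEquivalent.trans {p q r : NonsingularForm F} (h : WittEquivalent p q)
    (h' : WittEquivalent q r) : WittEquivalent p r := by
  obtain ⟨m, n, h⟩ := h
  obtain ⟨k, l, h'⟩ := h'
  refine ⟨m + k, l + n, ?_⟩
  have e1 : Isometric (orth p (hyperbolic F (m + k)))
      (orth (orth q (hyperbolic F n)) (hyperbolic F k)) :=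
    ((orth_congr (Isometric.refl _) (hyperbolic_add m k).symm).trans
      (orth_assoc _ _ _).symm).trans (orth_congr h (Isometric.refl _))
  have e2 : Isometric (orth (orth q (hyperbolic F n)) (hyperbolic F k))
      (orth (orth q (hyperbolic F k)) (hyperbolic F n)) :=
    ((orth_assoc _ _ _).trans (orth_congr (Isometric.refl _) (orth_comm _ _))).trans
      (orth_assoc _ _ _).symm
  exact ((e1.trans e2).trans (orth_congr h' (Isometric.refl _))).trans
    ((orth_assoc _ _ _).trans (orth_congr (Isometric.refl _) (hyperbolic_add l n)))

theorem WittEquivalent.orth {p p' q q' : NonsingularForm F} (h : WittEquivalent p p')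
    (h' : WittEquivalent q q') : WittEquivalent (orth p q) (orth p' q') := by
  obtain ⟨m, n, h⟩ := h
  obtain ⟨k, l, h'⟩ := h'
  exact ⟨m + k, n + l, (((orth_congr (Isometric.refl _) (hyperbolic_add m k).symm).trans
    (orth_orth_orth_comm _ _ _ _)).trans (orth_congr h h')).trans
    ((orth_orth_orth_comm _ _ _ _).trans (orth_congr (Isometric.refl _) (hyperbolic_add n l)))⟩

/-- The setoid of Witt equivalence. -/
instance wittSetoid (F : Type u) [Field F] : Setoid (NonsingularForm F) where
  r := WittEquivalent
  iseqv := ⟨fun p => (Isometric.refl p).wittEquivalent,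
    fun ⟨m, n, h⟩ => ⟨n, m, h.symm⟩, WittEquivalent.trans⟩

/-- The form `(v, f) ↦ f v` on `Fⁿ × Fⁿ` is the sum of `n` hyperbolic planes. -/
theorem exists_equiv_hyperbolic (n : ℕ) :
    ∃ e : ((Fin n → F) × (Fin n → F)) ≃ₗ[F] (hyperbolic F n).carrier,
      ∀ v, (hyperbolic F n).form (e v) = ∑ i, v.1 i * v.2 i := by
  induction n with
  | zero =>
    refine ⟨⟨⟨⟨fun _ => PUnit.unit, fun _ _ => rfl⟩, fun _ _ => rfl⟩, fun _ => 0,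
      fun _ => Subsingleton.elim _ _, fun _ => rfl⟩, fun v => ?_⟩
    exact (Finset.sum_empty).symm
  | succ n ih =>
    obtain ⟨e, he⟩ := ih
    let e₁ : ((Fin (n + 1) → F) × (Fin (n + 1) → F)) ≃ₗ[F]
        (F × F) × ((Fin n → F) × (Fin n → F)) :=
      ((Fin.consLinearEquiv F (fun _ : Fin (n + 1) => F)).symm.prodCongr
        (Fin.consLinearEquiv F (fun _ : Fin (n + 1) => F)).symm).trans
        (LinearEquiv.prodProdProdComm F F (Fin n → F) F (Fin n → F))
    refine ⟨e₁.trans ((LinearEquiv.refl F (F × F)).prodCongr e), fun v => ?_⟩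
    rw [Fin.sum_univ_succ]
    have : (hyperbolic F (n + 1)).form
        ((e₁.trans ((LinearEquiv.refl F (F × F)).prodCongr e)) v) =
        binaryForm 0 0 (v.1 0, v.2 0) +
          (hyperbolic F n).form (e (fun i => v.1 i.succ, fun i => v.2 i.succ)) := rfl
    refine this.trans ?_
    rw [he, binaryForm_apply]
    simp

/-- The negative `-q`; in characteristic two this is `q` itself. -/
def negForm (q : NonsingularForm F) : NonsingularForm F := scale (-1) q

theorem negForm_congr {p q : NonsingularForm F} (h : Isometric p q) :
    Isometric (negForm p) (negForm q) := by
  obtain ⟨e⟩ := h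
  exact ⟨⟨e.toLinearEquiv, fun v => by
    exact congrArg (fun t => ((-1 : Fˣ) : F) • t) (e.map_app v)⟩⟩

/-- `q ⊥ -q` is hyperbolic. -/
theorem orth_negForm (q : NonsingularForm F) :
    Isometric (orth q (negForm q)) (hyperbolic F (Module.finrank F q.carrier)) := by
  obtain ⟨B, hB⟩ := LinearMap.BilinMap.toQuadraticMap_surjective q.form
  have hB' : ∀ v, B v v = q.form v := fun v => by rw [← hB]; rfl
  let b := Module.finBasis F q.carrier
  let L : (q.carrier × q.carrier) →ₗ[F]
      ((Fin (Module.finrank F q.carrier) → F) × (Fin (Module.finrank F q.carrier) → F)) :=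
    LinearMap.prod
      (b.equivFun.toLinearMap ∘ₗ (LinearMap.fst F _ _ - LinearMap.snd F _ _))
      (LinearMap.pi fun i =>
        (B.flip (b i)) ∘ₗ (LinearMap.fst F _ _ - LinearMap.snd F _ _) +
          (q.form.polarBilin.flip (b i)) ∘ₗ LinearMap.snd F _ _)
  have hL : ∀ v w, ∑ i, (L (v, w)).1 i * (L (v, w)).2 i = q.form v - q.form w := by
    intro v w
    have h1 : ∑ i, (L (v, w)).1 i * (L (v, w)).2 i =
        B (v - w) (v - w) + QuadraticMap.polar q.form w (v - w) := by
      have h2 : B (v - w) (v - w) + QuadraticMap.polar q.form w (v - w) =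
          (B (v - w) + q.form.polarBilin w) (∑ i, b.equivFun (v - w) i • b i) := by
        rw [b.sum_equivFun]; rfl
      rw [h2, map_sum]
      refine Finset.sum_congr rfl fun i _ => ?_
      rw [map_smul]; rfl
    rw [h1, hB', QuadraticMap.polar, add_sub_cancel w v]
    ring
  have hinj : Function.Injective L := by
    rw [injective_iff_map_eq_zero]
    rintro ⟨v, w⟩ h
    have h1 : v - w = 0 := by
      have : b.equivFun (v - w) = 0 := congrArg Prod.fst h
      exact b.equivFun.map_eq_zero_iff.mp this
    have h2 : q.form.polarBilin w = 0 := by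
      refine b.ext fun i => ?_
      have : (B (v - w) + q.form.polarBilin w) (b i) = 0 := congrFun (congrArg Prod.snd h) i
      rw [h1] at this
      simpa using this
    have h3 : w = 0 := q.nonsingular w fun x => LinearMap.congr_fun h2 x
    rw [h3, sub_zero] at h1
    rw [h1, h3]; rfl
  have hdim : Module.finrank F (q.carrier × q.carrier) =
      Module.finrank F ((Fin (Module.finrank F q.carrier) → F) ×
        (Fin (Module.finrank F q.carrier) → F)) := by simp
  obtain ⟨e, he⟩ := exists_equiv_hyperbolic (F := F) (Module.finrank F q.carrier)
  refine ⟨⟨(LinearEquiv.ofInjectiveOfFinrankEq L hinj hdim).trans e, ?_⟩⟩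
  rintro ⟨v, w⟩
  have h1 : (hyperbolic F (Module.finrank F q.carrier)).form (e (L (v, w))) =
      q.form v - q.form w := (he _).trans (hL v w)
  refine h1.trans ?_
  change _ = q.form v + ((-1 : Fˣ) : F) • q.form w
  simp [sub_eq_add_neg]

theorem hyperbolic_wittEquivalent_zero (n : ℕ) :
    WittEquivalent (hyperbolic F n) (zeroForm F) :=
  ⟨0, n, orth_comm _ _⟩

theorem negForm_add_self (q : NonsingularForm F) :
    WittEquivalent (orth (negForm q) q) (zeroForm F) :=
  (((orth_comm _ _).trans (orth_negForm q)).wittEquivalent).trans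
    (hyperbolic_wittEquivalent_zero _)

theorem WittEquivalent.negForm {p q : NonsingularForm F} (h : WittEquivalent p q) :
    WittEquivalent (negForm p) (negForm q) := by
  have s := (wittSetoid F).iseqv
  have a1 : WittEquivalent p.negForm (p.negForm.orth (q.orth q.negForm)) :=
    (s.symm (((orth_comm _ _).wittEquivalent).trans
      (((s.refl _ : WittEquivalent (zeroForm F) (zeroForm F)).orth (s.refl p.negForm)).trans
        (zero_orth _).wittEquivalent))).trans
      ((s.refl p.negForm : WittEquivalent _ _).orth
        (s.symm (((orth_comm _ _).wittEquivalent).trans (negForm_add_self q))))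
  have a2 : WittEquivalent (p.negForm.orth (q.orth q.negForm))
      ((p.negForm.orth p).orth q.negForm) :=
    ((orth_assoc _ _ _).symm.wittEquivalent).trans
      (((s.refl p.negForm : WittEquivalent _ _).orth (s.symm h)).orth (s.refl q.negForm))
  exact (a1.trans a2).trans
    (((negForm_add_self p).orth (s.refl q.negForm)).trans (zero_orth _).wittEquivalent)

end NonsingularForm

open NonsingularForm in
/-- The Witt group `I_q F` of Witt classes of nonsingular quadratic forms (meant for fields of
characteristic two, where every nonsingular form has even dimension). -/
def QuadraticWittGroup (F : Type u) [Field F] : Type (u + 1) :=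
  Quotient (wittSetoid F)

namespace QuadraticWittGroup

open NonsingularForm

variable {F : Type u} [Field F]

/-- The Witt class of a nonsingular form. -/
def mk (q : NonsingularForm F) : QuadraticWittGroup F := Quotient.mk (wittSetoid F) q

instance : Zero (QuadraticWittGroup F) := ⟨mk (zeroForm F)⟩

instance : Add (QuadraticWittGroup F) :=
  ⟨Quotient.map₂ orth fun _ _ h _ _ h' => WittEquivalent.orth h h'⟩

instance : Neg (QuadraticWittGroup F) :=
  ⟨Quotient.map negForm fun _ _ h => WittEquivalent.negForm h⟩

/-- Addition is orthogonal sum, zero is the class of the hyperbolic forms. -/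
instance : AddCommGroup (QuadraticWittGroup F) where
  add_assoc := by
    rintro ⟨p⟩ ⟨q⟩ ⟨r⟩
    exact Quotient.sound (orth_assoc p q r).wittEquivalent
  zero_add := by
    rintro ⟨p⟩
    exact Quotient.sound (zero_orth p).wittEquivalent
  add_zero := by
    rintro ⟨p⟩
    exact Quotient.sound ((orth_comm _ _).trans (zero_orth p)).wittEquivalent
  add_comm := by
    rintro ⟨p⟩ ⟨q⟩
    exact Quotient.sound (orth_comm p q).wittEquivalent
  neg_add_cancel := by
    rintro ⟨p⟩
    exact Quotient.sound (negForm_add_self p)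
  nsmul := nsmulRec
  zsmul := zsmulRec

theorem mk_add (p q : NonsingularForm F) : mk p + mk q = mk (orth p q) := rfl

theorem mk_eq_iff (p q : NonsingularForm F) : mk p = mk q ↔ WittEquivalent p q :=
  ⟨fun h => Quotient.exact h, fun h => Quotient.sound h⟩

end QuadraticWittGroup

namespace NonsingularForm

variable {F : Type u} [Field F] [CharP F 2]

/-- The form `[1, b]`, that is `x² + x y + b y²`. -/
def pfisterOne (b : F) : NonsingularForm F where
  carrier := F × F
  form := binaryForm 1 b
  nonsingular := by
    rintro ⟨x, y⟩ h
    have h1 := h (0, 1)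
    have h2 := h (1, 0)
    have h0 : (2 : F) = 0 := CharTwo.two_eq_zero
    simp only [QuadraticMap.polar, binaryForm_apply, Prod.mk_add_mk] at h1 h2
    have hx : x = 0 := by linear_combination h1 - b * y * h0
    have hy : y = 0 := by linear_combination h2 - x * h0
    rw [hx, hy]; rfl

/-- The quadratic Pfister form `⟨⟨a₁, …, aₖ, b]] = ⟨1, a₁⟩ ⊗ ⋯ ⊗ ⟨1, aₖ⟩ ⊗ [1, b]`; here
`⟨1, a⟩ ⊗ q` is `q ⊥ a q`. -/
def pfister : List Fˣ → F → NonsingularForm F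
  | [], b => pfisterOne b
  | a :: l, b => orth (pfister l b) (scale a (pfister l b))

/-- `q` is (isometric to) a quadratic `n`-fold Pfister form. -/
def IsPfister (n : ℕ) (q : NonsingularForm F) : Prop :=
  ∃ (l : List Fˣ) (b : F), l.length + 1 = n ∧ Isometric q (pfister l b)

end NonsingularForm

/-- The quaternion algebra `[a, b)`, with `F`-basis `1, x, y, x y` and relations
`x² + x = a`, `y² = b`, `y x = (x + 1) y` (in characteristic two). -/
abbrev CharTwoQuaternion {F : Type u} [Field F] (a : F) (b : Fˣ) : Type u :=
  QuaternionAlgebra F a 1 (b : F)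

namespace CharTwoQuaternion

variable {F : Type u} [Field F] [CharP F 2]

theorem relations (a : F) (b : Fˣ) :
    let x : CharTwoQuaternion a b := ⟨0, 1, 0, 0⟩
    let y : CharTwoQuaternion a b := ⟨0, 0, 1, 0⟩
    x * x + x = algebraMap F _ a ∧ y * y = algebraMap F _ (b : F) ∧ y * x = (x + 1) * y ∧
      x * y = ⟨0, 0, 0, 1⟩ := by
  have h : (1 : F) + 1 = 0 := CharTwo.add_self_eq_zero 1
  have h' : (-1 : F) = 1 := CharTwo.neg_eq 1
  refine ⟨?_, ?_, ?_, ?_⟩ <;> ext <;> simp [h, h', QuaternionAlgebra.algebraMap_eq]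

/-- The norm form `z ↦ z z̄` of the quaternion algebra `[a, b)`; the value lies in `F`. -/
def normMap (a : F) (b : Fˣ) : QuadraticForm F (CharTwoQuaternion a b) :=
  LinearMap.BilinMap.toQuadraticMap (LinearMap.mk₂ F (fun z w : CharTwoQuaternion a b => (z * star w).re)
    (fun _ _ _ => by rw [add_mul, QuaternionAlgebra.re_add])
    (fun _ _ _ => by rw [smul_mul_assoc, QuaternionAlgebra.re_smul])
    (fun _ _ _ => by rw [star_add, mul_add, QuaternionAlgebra.re_add])
    (fun _ _ _ => by
      rw [QuaternionAlgebra.star_smul, mul_smul_comm, QuaternionAlgebra.re_smul]))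

theorem normMap_apply (a : F) (b : Fˣ) (z : CharTwoQuaternion a b) :
    normMap a b z = (z.re ^ 2 + z.re * z.imI + a * z.imI ^ 2) +
      b * (z.imJ ^ 2 + z.imJ * z.imK + a * z.imK ^ 2) := by
  have h : (2 : F) = 0 := CharTwo.two_eq_zero
  simp [normMap]
  linear_combination (-(a * z.imI ^ 2) - b * (z.imJ ^ 2 + z.imJ * z.imK)) * h

theorem coe_normMap (a : F) (b : Fˣ) (z : CharTwoQuaternion a b) :
    algebraMap F _ (normMap a b z) = z * star z := by
  ext
  · simp [normMap, QuaternionAlgebra.algebraMap_eq]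
  all_goals
    simp [QuaternionAlgebra.algebraMap_eq]
    try ring

/-- The norm form of `[a, b)` as a nonsingular quadratic form. -/
def normForm (a : F) (b : Fˣ) : NonsingularForm F where
  carrier := CharTwoQuaternion a b
  form := normMap a b
  nonsingular := by
    intro z h
    have h0 : (2 : F) = 0 := CharTwo.two_eq_zero
    have h1 := h ⟨1, 0, 0, 0⟩
    have h2 := h ⟨0, 1, 0, 0⟩
    have h3 := h ⟨0, 0, 1, 0⟩
    have h4 := h ⟨0, 0, 0, 1⟩
    simp only [QuadraticMap.polar, normMap_apply, QuaternionAlgebra.re_add,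
      QuaternionAlgebra.imI_add, QuaternionAlgebra.imJ_add, QuaternionAlgebra.imK_add]
      at h1 h2 h3 h4
    have hb : (b : F) ≠ 0 := b.ne_zero
    ext
    · simpa using show z.re = 0 by linear_combination h2 - a * z.imI * h0
    · simpa using show z.imI = 0 by linear_combination h1 - z.re * h0
    · simpa using mul_left_cancel₀ hb
        (show (b : F) * z.imJ = b * 0 by linear_combination h4 - a * b * z.imK * h0)
    · simpa using mul_left_cancel₀ hb
        (show (b : F) * z.imK = b * 0 by linear_combination h3 - b * z.imJ * h0)

/-- The norm form of `[a, b)` is `⟨⟨b, a]]`. -/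
theorem normForm_isometric (a : F) (b : Fˣ) :
    (normForm a b).Isometric (NonsingularForm.pfister [b] a) := by
  refine ⟨⟨⟨⟨⟨fun z => ((z.re, z.imI), (z.imJ, z.imK)), fun _ _ => rfl⟩, fun _ _ => ?_⟩,
    fun v => ⟨v.1.1, v.1.2, v.2.1, v.2.2⟩, fun _ => rfl, fun _ => rfl⟩, fun z => ?_⟩⟩
  · rfl
  · have key : ∀ z : CharTwoQuaternion a b, NonsingularForm.binaryForm 1 a (z.re, z.imI) +
        (b : F) • NonsingularForm.binaryForm 1 a (z.imJ, z.imK) = normMap a b z := by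
      intro z
      rw [NonsingularForm.binaryForm_apply, NonsingularForm.binaryForm_apply, normMap_apply]
      simp
    exact key z

end CharTwoQuaternion

namespace QuadraticWittGroup

open NonsingularForm

variable {F : Type u} [Field F] [CharP F 2]

/-- `I_q^n F`: the subgroup of the Witt group generated by the scalar multiples of quadratic
`n`-fold Pfister forms. -/
def power (F : Type u) [Field F] [CharP F 2] (n : ℕ) : AddSubgroup (QuadraticWittGroup F) :=
  AddSubgroup.closure {x | ∃ (c : Fˣ) (q : NonsingularForm F), IsPfister n q ∧ x = mk (scale c q)}

/-- The class of `q` modulo `I_q^{n+1} F`. -/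
def classMod (n : ℕ) (q : NonsingularForm F) : QuadraticWittGroup F ⧸ power F (n + 1) :=
  QuotientAddGroup.mk (mk q)

/-- The subgroup generated by the classes of the forms in `S`. For `S` a set of quadratic `n`-fold
Pfister forms, it lies in the subgroup `I_q^n F / I_q^{n+1} F` of `I_q F / I_q^{n+1} F`. -/
def generated (n : ℕ) (S : Set (NonsingularForm F)) :
    AddSubgroup (QuadraticWittGroup F ⧸ power F (n + 1)) :=
  AddSubgroup.closure (classMod n '' S)

/-- `q` is a quadratic `n`-fold Pfister form representing the class `g`. -/
def Represents (n : ℕ) (q : NonsingularForm F) (g : QuadraticWittGroup F ⧸ power F (n + 1)) :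
    Prop :=
  IsPfister n q ∧ classMod n q = g

/-- A set of quadratic `n`-fold Pfister forms is tight if every element of the subgroup of
`I_q^n F / I_q^{n+1} F` generated by it is represented by a quadratic `n`-fold Pfister form. -/
def IsTight (n : ℕ) (S : Set (NonsingularForm F)) : Prop :=
  (∀ q ∈ S, IsPfister n q) ∧
    ∀ g ∈ generated n S, ∃ q : NonsingularForm F, Represents n q g

/-- `σ` is the invariant `Σ_S` of the finite tight set `S`: the Witt class of the orthogonal sum
of the quadratic `n`-fold Pfister representatives of the elements of the (finite) group generated
by `S`, for any choice of these representatives. -/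
def IsSigma (n : ℕ) (S : Set (NonsingularForm F)) (σ : QuadraticWittGroup F) : Prop :=
  IsTight n S ∧ Finite (generated n S) ∧
    ∀ rep : generated n S → NonsingularForm F, (∀ g, Represents n (rep g) g) →
      ∑ᶠ g, mk (rep g) = σ

/-- The variant of `Σ` for a finite family, with one summand for each formal combination of its
members: `σ` is the Witt class of the orthogonal sum, over all sets `T` of indices, of the
quadratic `n`-fold Pfister forms representing the sum of the `q i` with `i ∈ T`, for any choice of
these representatives. For a family whose classes are linearly independent over the field with two
elements this is `IsSigma` of its range. -/
def IsFamilySigma (n : ℕ) {ι : Type} [Fintype ι] (q : ι → NonsingularForm F)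
    (σ : QuadraticWittGroup F) : Prop :=
  IsTight n (Set.range q) ∧
    ∀ rep : Finset ι → NonsingularForm F,
      (∀ T, Represents n (rep T) (∑ i ∈ T, classMod n (q i))) →
      ∑ T, mk (rep T) = σ

end QuadraticWittGroup

theorem CharTwo.sq_add_ne_zero {F : Type u} [Field F] [CharP F 2] {a b : F} (h : b ≠ a ^ 2) :
    a ^ 2 + b ≠ 0 := by
  intro h'
  exact h (CharTwo.add_eq_zero.mp h').symm

/-!
The argument has two independent halves.

*Representatives are unique up to Witt equivalence.* In characteristic two the Clifford algebra of
an orthogonal sum is the ordinary tensor product of the Clifford algebras, so forms with split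
Clifford algebra are closed under orthogonal sums. To avoid Brauer groups, "split" is expressed as
`QuadraticForm.HasSpinor`: there is a Clifford module `M` with `(dim M)² = 2 ^ dim q`. This
property is invariant under Witt equivalence, because an isotropic operator `e` of a hyperbolic
plane has a kernel of half the dimension, stable under the rest of the form. A multiple
`c N ⊥ c a N` of a 3-fold Pfister form, `N` the norm form of a quaternion algebra `A`, has such a
module `A⁴`, on which the two summands act by left and by right multiplications. Hence every form
in `I_q³ F` has a spinor module (`QuadraticWittGroup.power_three_le_spinorial`).

If two 2-fold Pfister forms, the norm forms of `A` and `B`, agree modulo `I_q³ F`, their sum has a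
spinor module of dimension 16. Two commuting idempotents cut out of it a space `W` of dimension 4
on which `A` and `B` act by commuting operators. If `A` and `B` are division algebras, the equation
`v w = t w` for a fixed nonzero `w ∈ W` matches `v ∈ A` with `t ∈ B` and preserves norms; if one of
them is not a division algebra then neither is, and both norm forms are hyperbolic
(`QuadraticWittGroup.mk_eq_of_classMod_eq`). So each invariant can be computed from a single choice
of representatives, provided that one exists.

*Explicit representatives.* Let `D(c, a)` be the Witt class of `c [1, a]`. It is additive in `a`,
satisfies `D(c, a²) = D(c, a)`, and `D(c n, a) = D(c, a)` for every nonzero value `n` of `[1, a]`,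
in particular for `n = a`. Write `(b; a)` for `⟨⟨b, a]]`, of class `D(1, a) + D(b, a)`, and put
`ε = α² + β`, `δ = β + α⁴ β⁻¹`. Modulo `I_q³ F`, where `(b; a) + (c; a) = (b c; a)`, the eight
subset sums of `ψ = (γ; δ)`, `φ = (γ ε; δ)` and `π = (γ; ε)` are represented by `0`, the three forms
themselves, and

* `ψ + φ = (ε; δ) = (β; α)`, by `QuadraticWittGroup.mk_pfister_eq`,
* `ψ + π = (γ; δ + ε)`,
* `φ + π = (γ ε; δ + ε)`, as `(γ; ε) = (γ ε; ε)`,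
* `ψ + φ + π = (β γ; α + β)`, as `(γ; ε) = (γ; α) + (γ; β) = (γ; α) + (β γ; β)`.

Expanding the sum of the eight in the Witt group, a group of exponent two, leaves
`(β; α) + (γ; α) + (β γ; α) = ⟨⟨γ, β, α]]`.
-/

/-! ### Witt classes of binary forms -/

namespace QuadraticWittGroup

open NonsingularForm

variable {F : Type u} [Field F]

theorem mk_eq_of_isometric {p q : NonsingularForm F} (h : Isometric p q) : mk p = mk q :=
  (mk_eq_iff p q).2 h.wittEquivalent

theorem mk_hyperbolicPlane : mk (hyperbolicPlane F) = 0 :=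
  (mk_eq_of_isometric ((orth_comm _ _).trans (zero_orth _)).symm).trans
    ((mk_eq_iff _ _).2 (hyperbolic_wittEquivalent_zero 1))

theorem scale_congr (c : Fˣ) {p q : NonsingularForm F} (h : Isometric p q) :
    Isometric (scale c p) (scale c q) := by
  obtain ⟨e⟩ := h
  exact ⟨⟨e.toLinearEquiv, fun v => congrArg (fun t => (c : F) • t) (e.map_app v)⟩⟩

theorem scale_orth (c : Fˣ) (p q : NonsingularForm F) :
    Isometric (scale c (orth p q)) (orth (scale c p) (scale c q)) :=
  ⟨⟨LinearEquiv.refl F (p.carrier × q.carrier), fun v =>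
    (smul_add (c : F) (p.form v.1) (q.form v.2)).symm⟩⟩

theorem scale_scale (c d : Fˣ) (q : NonsingularForm F) :
    Isometric (scale c (scale d q)) (scale (c * d) q) :=
  ⟨⟨LinearEquiv.refl F q.carrier, fun v =>
    (mul_assoc (c : F) (d : F) (q.form v))⟩⟩

theorem scale_one (q : NonsingularForm F) : Isometric (scale 1 q) q :=
  ⟨⟨LinearEquiv.refl F q.carrier, fun v => (one_mul (q.form v)).symm⟩⟩

theorem hyperbolicPlane_apply (v : F × F) : (hyperbolicPlane F).form v = v.1 * v.2 := by
  change binaryForm 0 0 v = _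
  rw [binaryForm_apply]
  ring

variable [CharP F 2]

theorem add_self (x : QuadraticWittGroup F) : x + x = 0 := by
  obtain ⟨q⟩ := x
  have h : Isometric (negForm q) q := by
    have : (-1 : Fˣ) = 1 := Units.ext (CharTwo.neg_eq 1)
    rw [negForm, this]
    exact scale_one q
  exact (mk_eq_of_isometric (orth_congr h.symm (Isometric.refl q))).trans
    ((mk_eq_iff _ _).2 (negForm_add_self q))

theorem neg_eq (x : QuadraticWittGroup F) : -x = x :=
  neg_eq_of_add_eq_zero_left (add_self x)

theorem add_eq_zero_iff {x y : QuadraticWittGroup F} : x + y = 0 ↔ x = y := by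
  rw [add_eq_zero_iff_eq_neg, neg_eq]

/-- The Witt class of the binary form `c [1, a]`. -/
def binaryClass (c : Fˣ) (a : F) : QuadraticWittGroup F := mk (scale c (pfisterOne a))

theorem mk_pfister_two (b : Fˣ) (a : F) :
    mk (pfister [b] a) = binaryClass 1 a + binaryClass b a :=
  mk_eq_of_isometric (orth_congr (scale_one _).symm (Isometric.refl _))

theorem mk_scale_pfister_two (c b : Fˣ) (a : F) :
    mk (scale c (pfister [b] a)) = binaryClass c a + binaryClass (c * b) a :=
  mk_eq_of_isometric ((scale_orth _ _ _).trans
    (orth_congr (Isometric.refl _) (scale_scale _ _ _)))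

theorem mk_pfister_three (c b : Fˣ) (a : F) :
    mk (pfister [c, b] a) =
      (binaryClass 1 a + binaryClass b a) + (binaryClass c a + binaryClass (c * b) a) := by
  rw [← mk_pfister_two, ← mk_scale_pfister_two]
  rfl

theorem scale_pfisterOne_apply (c : Fˣ) (a : F) (v : F × F) :
    (scale c (pfisterOne a)).form v = c * (v.1 ^ 2 + v.1 * v.2 + a * v.2 ^ 2) := by
  change (c : F) • binaryForm 1 a v = _
  rw [binaryForm_apply, smul_eq_mul, one_mul]

/-- The isotropic vector `(1, 0, 1, 0)` splits off a hyperbolic plane. -/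
theorem binaryClass_add (c : Fˣ) (a a' : F) :
    binaryClass c a + binaryClass c a' = binaryClass c (a + a') := by
  have h2 : (2 : F) = 0 := CharTwo.two_eq_zero
  have hc : (c : F)⁻¹ * c = 1 := inv_mul_cancel₀ c.ne_zero
  let e : ((F × F) × (F × F)) ≃ₗ[F] ((F × F) × (F × F)) :=
    { toFun := fun v => ((v.1.1 + v.2.1, v.2.2),
        (c * (v.1.1 + a * (v.1.2 + v.2.2)), v.1.2 + v.2.2))
      map_add' := fun v w => by
        ext <;> simp only [Prod.fst_add, Prod.snd_add, Prod.mk_add_mk] <;> ring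
      map_smul' := fun r v => by
        ext <;> simp only [Prod.smul_fst, Prod.smul_snd, Prod.smul_mk, smul_eq_mul,
          RingHom.id_apply] <;> ring
      invFun := fun v => (((c : F)⁻¹ * v.2.1 + a * v.2.2, v.2.2 + v.1.2),
        (v.1.1 + ((c : F)⁻¹ * v.2.1 + a * v.2.2), v.1.2))
      left_inv := fun v => by
        ext <;> simp only
        · linear_combination (v.1.1 + a * (v.1.2 + v.2.2)) * hc + a * (v.1.2 + v.2.2) * h2
        · linear_combination v.2.2 * h2
        · linear_combination (v.1.1 + a * (v.1.2 + v.2.2)) * (hc + h2)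
      right_inv := fun v => by
        ext <;> simp only
        · linear_combination ((c : F)⁻¹ * v.2.1 + a * v.2.2) * h2
        · linear_combination v.2.1 * hc + c * a * (v.2.2 + v.1.2) * h2
        · linear_combination v.1.2 * h2 }
  have h : Isometric (orth (scale c (pfisterOne a)) (scale c (pfisterOne a')))
      (orth (scale c (pfisterOne (a + a'))) (hyperbolicPlane F)) := by
    refine ⟨⟨e, fun v => ?_⟩⟩
    refine (congrArg₂ (· + ·) (scale_pfisterOne_apply c _ (e v).1)
      (hyperbolicPlane_apply (e v).2)).trans (Eq.trans ?_ (congrArg₂ (· + ·)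
        (scale_pfisterOne_apply c a v.1) (scale_pfisterOne_apply c a' v.2)).symm)
    obtain ⟨⟨x, y⟩, z, w⟩ := v
    simp only [e, LinearEquiv.coe_mk, LinearMap.coe_mk, AddHom.coe_mk]
    linear_combination (c * (x * z + x * w + a * w ^ 2 + a * y * w)) * h2
  calc binaryClass c a + binaryClass c a' = binaryClass c (a + a') + mk (hyperbolicPlane F) :=
        mk_eq_of_isometric h
    _ = _ := by rw [mk_hyperbolicPlane, add_zero]

/-- The form `[1, s² + s]` is hyperbolic, as `x² + x y + (s² + s) y² = (x + s y) (x + s y + y)`. -/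
theorem binaryClass_sq_add (c : Fˣ) (s : F) : binaryClass c (s ^ 2 + s) = 0 := by
  have h2 : (2 : F) = 0 := CharTwo.two_eq_zero
  have hc : (c : F) ≠ 0 := c.ne_zero
  let e : (F × F) ≃ₗ[F] (F × F) :=
    { toFun := fun v => (c * (v.1 + s * v.2), v.1 + s * v.2 + v.2)
      map_add' := fun v w => by
        ext <;> simp only [Prod.fst_add, Prod.snd_add, Prod.mk_add_mk] <;> ring
      map_smul' := fun r v => by
        ext <;> simp only [Prod.smul_fst, Prod.smul_snd, Prod.smul_mk, smul_eq_mul,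
          RingHom.id_apply] <;> ring
      invFun := fun v => ((c : F)⁻¹ * v.1 + s * ((c : F)⁻¹ * v.1 + v.2), (c : F)⁻¹ * v.1 + v.2)
      left_inv := fun v => by
        ext <;> simp only <;> field_simp
        · linear_combination (s * v.1 + s ^ 2 * v.2 + s * v.2) * h2
        · linear_combination (v.1 + s * v.2) * h2
      right_inv := fun v => by
        ext <;> simp only <;> field_simp
        · linear_combination (s * (v.1 + c * v.2)) * h2
        · linear_combination (v.1 + s * (v.1 + c * v.2)) * h2 }
  refine (mk_eq_of_isometric ?_).trans mk_hyperbolicPlane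
  refine ⟨⟨e, fun v => ?_⟩⟩
  refine (hyperbolicPlane_apply (e v)).trans (Eq.trans ?_ (scale_pfisterOne_apply c _ v).symm)
  simp only [e, LinearEquiv.coe_mk, LinearMap.coe_mk, AddHom.coe_mk]
  linear_combination (c * s * v.1 * v.2) * h2

theorem binaryClass_zero (c : Fˣ) : binaryClass c (0 : F) = 0 := by
  simpa using binaryClass_sq_add c (0 : F)

theorem binaryClass_sq (c : Fˣ) (a : F) : binaryClass c (a ^ 2) = binaryClass c a := by
  rw [← add_eq_zero_iff, binaryClass_add, binaryClass_sq_add]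

/-- A nonzero value `n` of the multiplicative form `[1, a]` is a similarity factor of it; the
isometry is multiplication by `r + s ω` in `F[ω]`, where `ω² = ω + a`. -/
theorem binaryClass_mul (c n : Fˣ) (a r s : F) (hn : (n : F) = r ^ 2 + r * s + a * s ^ 2) :
    binaryClass (c * n) a = binaryClass c a := by
  have h2 : (2 : F) = 0 := CharTwo.two_eq_zero
  have hn0 : (n : F)⁻¹ * (r ^ 2 + r * s + a * s ^ 2) = 1 := by
    rw [← hn, inv_mul_cancel₀ n.ne_zero]
  let e : (F × F) ≃ₗ[F] (F × F) :=
    { toFun := fun v => (r * v.1 + a * s * v.2, r * v.2 + s * v.1 + s * v.2)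
      map_add' := fun v w => by
        ext <;> simp only [Prod.fst_add, Prod.snd_add, Prod.mk_add_mk] <;> ring
      map_smul' := fun r v => by
        ext <;> simp only [Prod.smul_fst, Prod.smul_snd, Prod.smul_mk, smul_eq_mul,
          RingHom.id_apply] <;> ring
      invFun := fun v => ((n : F)⁻¹ * ((r + s) * v.1 + a * s * v.2),
        (n : F)⁻¹ * (r * v.2 + s * v.1))
      left_inv := fun v => by
        ext <;> simp only
        · linear_combination v.1 * hn0 + (n : F)⁻¹ * (a * s * v.2 * (r + s)) * h2
        · linear_combination v.2 * hn0 + (n : F)⁻¹ * (r * s * v.1) * h2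
      right_inv := fun v => by
        ext <;> simp only
        · linear_combination v.1 * hn0 + (n : F)⁻¹ * (r * a * s * v.2) * h2
        · linear_combination v.2 * hn0 + (n : F)⁻¹ * (r * s * v.1 + s ^ 2 * v.1) * h2 }
  refine mk_eq_of_isometric ⟨⟨e, fun v => ?_⟩⟩
  refine (scale_pfisterOne_apply c a (e v)).trans
    (Eq.trans ?_ (scale_pfisterOne_apply (c * n) a v).symm)
  simp only [e, LinearEquiv.coe_mk, LinearMap.coe_mk, AddHom.coe_mk, Units.val_mul, hn]
  linear_combination (c * (2 * r * a * s * v.1 * v.2 + a * s ^ 2 * v.1 * v.2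
    + a * r * s * v.2 ^ 2 + a * s ^ 2 * v.2 ^ 2)) * h2

theorem binaryClass_mul_self (c n : Fˣ) : binaryClass (c * n) (n : F) = binaryClass c (n : F) :=
  binaryClass_mul c n n 0 1 (by ring)

theorem binaryClass_mul_sq (c n : Fˣ) (a : F) : binaryClass (c * n ^ 2) a = binaryClass c a :=
  binaryClass_mul c (n ^ 2) a n 0 (by push_cast; ring)

end QuadraticWittGroup

/-! ### Clifford modules and the spinor condition -/

namespace QuadraticForm

open Module NonsingularForm

variable {F : Type u} [Field F] {V W M : Type u} [AddCommGroup V] [Module F V]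
  [AddCommGroup W] [Module F W] [AddCommGroup M] [Module F M]

/-- A linear map `ρ : V → End M` makes `M` a module over the Clifford algebra of `Q` when
`ρ(v)² = Q(v)`. -/
def IsCliffordAction (Q : QuadraticForm F V) (ρ : V →ₗ[F] End F M) : Prop :=
  ∀ v, ρ v * ρ v = Q v • (1 : End F M)

/-- `Q` has a spinor module: a Clifford module `M` with `(dim M)² = 2 ^ dim Q`. For nonsingular
`Q` this says that the Clifford algebra, which has dimension `2 ^ dim Q`, is split. -/
def HasSpinor (Q : QuadraticForm F V) : Prop :=
  ∃ (M : Type u) (_ : AddCommGroup M) (_ : Module F M) (_ : FiniteDimensional F M)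
    (ρ : V →ₗ[F] End F M), IsCliffordAction Q ρ ∧ finrank F M ^ 2 = 2 ^ finrank F V

theorem IsCliffordAction.mul_add_mul {Q : QuadraticForm F V} {ρ : V →ₗ[F] End F M}
    (h : IsCliffordAction Q ρ) (v w : V) :
    ρ v * ρ w + ρ w * ρ v = QuadraticMap.polar Q v w • (1 : End F M) := by
  have h1 := h (v + w)
  rw [map_add] at h1
  rw [QuadraticMap.polar, sub_smul, sub_smul, ← h1, ← h v, ← h w]
  noncomm_ring

/-- In characteristic two, operators of orthogonal vectors commute. -/
theorem IsCliffordAction.commute [CharP F 2] {Q : QuadraticForm F V} {ρ : V →ₗ[F] End F M}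
    (h : IsCliffordAction Q ρ) {v w : V} (hvw : QuadraticMap.polar Q v w = 0) :
    Commute (ρ v) (ρ w) := by
  have h1 := h.mul_add_mul v w
  have h2 : ρ v * ρ w + ρ v * ρ w = 0 := by
    rw [← two_smul F, CharTwo.two_eq_zero, zero_smul]
  rw [hvw, zero_smul] at h1
  exact (add_left_cancel (h1.trans h2.symm)).symm

theorem IsCliffordAction.inl {P : QuadraticForm F V} {Q : QuadraticForm F W}
    {ρ : V × W →ₗ[F] End F M} (h : IsCliffordAction (P.prod Q) ρ) :
    IsCliffordAction P (ρ ∘ₗ LinearMap.inl F V W) := fun v =>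
  (h (v, 0)).trans (by simp)

theorem IsCliffordAction.inr {P : QuadraticForm F V} {Q : QuadraticForm F W}
    {ρ : V × W →ₗ[F] End F M} (h : IsCliffordAction (P.prod Q) ρ) :
    IsCliffordAction Q (ρ ∘ₗ LinearMap.inr F V W) := fun v =>
  (h (0, v)).trans (by simp)

theorem IsCliffordAction.commute_inl_inr [CharP F 2] {P : QuadraticForm F V}
    {Q : QuadraticForm F W} {ρ : V × W →ₗ[F] End F M} (h : IsCliffordAction (P.prod Q) ρ)
    (v : V) (w : W) :
    Commute ((ρ ∘ₗ LinearMap.inl F V W) v) ((ρ ∘ₗ LinearMap.inr F V W) w) :=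
  h.commute (by simp [QuadraticMap.polar])

theorem HasSpinor.congr {P : QuadraticForm F V} {Q : QuadraticForm F W}
    (e : P.IsometryEquiv Q) (hp : HasSpinor P) : HasSpinor Q := by
  obtain ⟨M, _, _, _, ρ, hρ, hd⟩ := hp
  refine ⟨M, _, _, ‹_›, ρ ∘ₗ e.symm.toLinearEquiv.toLinearMap, fun v => ?_, ?_⟩
  · have := e.symm.map_app v
    exact (hρ (e.symm v)).trans (by rw [this])
  · rw [hd, e.toLinearEquiv.finrank_eq]

theorem hasSpinor_of_subsingleton [Subsingleton V] (Q : QuadraticForm F V) : HasSpinor Q := by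
  refine ⟨F, inferInstance, inferInstance, inferInstance, 0, fun v => ?_, ?_⟩
  · simp [Subsingleton.elim v 0]
  · simp [finrank_zero_of_subsingleton (R := F) (M := V)]

theorem hasSpinor_hyperbolicPlane : HasSpinor (binaryForm (0 : F) 0) := by
  refine ⟨F × F, inferInstance, inferInstance, inferInstance,
    LinearMap.mk₂ F (fun v x => (v.1 * x.2, v.2 * x.1))
      (fun v w x => by ext <;> simp [add_mul]) (fun r v x => by ext <;> simp [mul_assoc])
      (fun v x y => by ext <;> simp [mul_add]) (fun r v x => by ext <;> simp [mul_left_comm]),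
    fun v => ?_, by simp⟩
  ext <;> simp [binaryForm_apply, mul_comm]

/-- In characteristic two the Clifford algebra of an orthogonal sum is the ordinary tensor
product, so spinor modules can be tensored. -/
theorem HasSpinor.prod [CharP F 2] [FiniteDimensional F V] [FiniteDimensional F W]
    {P : QuadraticForm F V} {Q : QuadraticForm F W} (hp : HasSpinor P) (hq : HasSpinor Q) :
    HasSpinor (P.prod Q) := by
  obtain ⟨M, _, _, _, ρ, hρ, hd⟩ := hp
  obtain ⟨N, _, _, _, τ, hτ, hd'⟩ := hq
  refine ⟨TensorProduct F M N, inferInstance, inferInstance, inferInstance,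
    LinearMap.coprod (LinearMap.rTensorHom N ∘ₗ ρ) (LinearMap.lTensorHom M ∘ₗ τ), ?_, ?_⟩
  · rintro ⟨v, w⟩
    refine TensorProduct.ext' fun m n => ?_
    have e1 : ρ v (ρ v m) = P v • m := LinearMap.congr_fun (hρ v) m
    have e2 : τ w (τ w n) = Q w • n := LinearMap.congr_fun (hτ w) n
    have h3 (t : TensorProduct F M N) : t + t = 0 := by
      rw [← two_smul F, CharTwo.two_eq_zero, zero_smul]
    simp only [Module.End.mul_apply, LinearMap.coprod_apply, LinearMap.comp_apply,
      LinearMap.coe_rTensorHom, LinearMap.coe_lTensorHom, LinearMap.add_apply,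
      LinearMap.rTensor_tmul, LinearMap.lTensor_tmul, map_add, e1, e2, LinearMap.smul_apply,
      Module.End.one_apply, ← TensorProduct.smul_tmul', TensorProduct.tmul_smul, add_smul,
      QuadraticMap.prod_apply]
    have := h3 (TensorProduct.tmul F (ρ v m) (τ w n))
    rw [add_assoc, ← add_assoc (TensorProduct.tmul F (ρ v m) (τ w n)), this, zero_add]
  · rw [finrank_tensorProduct, mul_pow, hd, hd', ← pow_add, finrank_prod]

/-- If `e² = f² = 0` and `e f + f e = 1` on a Clifford module, then the kernel of `e` has half the
dimension, and in characteristic two it is stable under the operators of the complement. -/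
theorem HasSpinor.of_prod_hyperbolicPlane [CharP F 2] [FiniteDimensional F V]
    {Q : QuadraticForm F V} (h : HasSpinor (Q.prod (binaryForm 0 0))) : HasSpinor Q := by
  obtain ⟨M, _, _, _, ρ, hρ, hd⟩ := h
  let σ : V →ₗ[F] End F M := ρ ∘ₗ LinearMap.inl F V (F × F)
  let τ : F × F →ₗ[F] End F M := ρ ∘ₗ LinearMap.inr F V (F × F)
  let e : End F M := τ (1, 0)
  let f : End F M := τ (0, 1)
  have he : e * e = 0 := (hρ.inr _).trans (by simp [binaryForm_apply])
  have hef : e * f + f * e = 1 :=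
    (hρ.inr.mul_add_mul _ _).trans (by simp [QuadraticMap.polar, binaryForm_apply])
  have hc : ∀ v, e * σ v = σ v * e := fun v => (hρ.commute_inl_inr v (1, 0)).symm.eq
  have hrk : LinearMap.range e = LinearMap.ker e := by
    apply le_antisymm
    · rintro _ ⟨x, rfl⟩
      exact LinearMap.congr_fun he x
    · intro x hx
      rw [LinearMap.mem_ker] at hx
      refine ⟨f x, ?_⟩
      have := LinearMap.congr_fun hef x
      simpa [hx] using this
  have hdim : finrank F M = 2 * finrank F (LinearMap.ker e) := by
    rw [← e.finrank_range_add_finrank_ker, hrk, two_mul]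
  have hst : ∀ v, ∀ x ∈ LinearMap.ker e, σ v x ∈ LinearMap.ker e := fun v x hx => by
    have := LinearMap.congr_fun (hc v) x
    rw [LinearMap.mem_ker] at hx ⊢
    simpa [hx] using this
  let θ : V →ₗ[F] End F (LinearMap.ker e) :=
    { toFun := fun v => (σ v).restrict (hst v)
      map_add' := fun v w => by ext x; simp [LinearMap.restrict_apply]
      map_smul' := fun r v => by ext x; simp [LinearMap.restrict_apply] }
  refine ⟨LinearMap.ker e, inferInstance, inferInstance, inferInstance, θ, fun v => ?_, ?_⟩
  · ext x
    exact LinearMap.congr_fun (hρ.inl v) x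
  · have : finrank F (V × (F × F)) = finrank F V + 2 := by simp
    rw [this, hdim, mul_pow, pow_add, mul_comm] at hd
    exact Nat.eq_of_mul_eq_mul_right (by norm_num) hd

end QuadraticForm

namespace NonsingularForm

open QuadraticForm

variable {F : Type u} [Field F]

theorem hasSpinor_hyperbolic [CharP F 2] (n : ℕ) : HasSpinor (hyperbolic F n).form := by
  induction n with
  | zero => exact hasSpinor_of_subsingleton (V := PUnit.{u + 1}) 0
  | succ n ih => exact hasSpinor_hyperbolicPlane.prod ih

theorem hasSpinor_of_orth_hyperbolic [CharP F 2] {q : NonsingularForm F} (n : ℕ)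
    (h : HasSpinor (orth q (hyperbolic F n)).form) : HasSpinor q.form := by
  induction n with
  | zero =>
    obtain ⟨e⟩ := (orth_comm _ _).trans (zero_orth q)
    exact h.congr e
  | succ n ih =>
    obtain ⟨e⟩ := (orth_congr (Isometric.refl q) (orth_comm _ (hyperbolic F n))).trans
      (orth_assoc _ _ _).symm
    exact ih (HasSpinor.of_prod_hyperbolicPlane (h.congr e))

theorem hasSpinor_of_wittEquivalent [CharP F 2] {p q : NonsingularForm F}
    (h : WittEquivalent p q) (hp : HasSpinor p.form) : HasSpinor q.form := by
  obtain ⟨m, n, ⟨e⟩⟩ := h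
  exact hasSpinor_of_orth_hyperbolic n ((hp.prod (hasSpinor_hyperbolic m)).congr e)

end NonsingularForm

namespace QuadraticWittGroup

open NonsingularForm QuadraticForm Module

variable {F : Type u} [Field F] [CharP F 2]

/-- The Witt classes of forms with a spinor module form a subgroup. -/
def spinorial (F : Type u) [Field F] [CharP F 2] : AddSubgroup (QuadraticWittGroup F) where
  carrier := {x | ∃ q : NonsingularForm F, HasSpinor q.form ∧ mk q = x}
  zero_mem' := ⟨_, hasSpinor_of_subsingleton (V := PUnit.{u + 1}) 0, rfl⟩
  add_mem' := by
    rintro _ _ ⟨p, hp, rfl⟩ ⟨q, hq, rfl⟩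
    exact ⟨orth p q, hp.prod hq, rfl⟩
  neg_mem' := by
    rintro _ ⟨p, hp, rfl⟩
    exact ⟨p, hp, (neg_eq _).symm⟩

theorem mk_mem_spinorial {q : NonsingularForm F} : mk q ∈ spinorial F ↔ HasSpinor q.form :=
  ⟨fun ⟨_, hp, h⟩ => hasSpinor_of_wittEquivalent ((mk_eq_iff _ _).1 h) hp, fun h => ⟨q, h, rfl⟩⟩

/-- Let `A` be a four-dimensional algebra with an `F`-linear involution and norm form `N`, for
example a quaternion algebra. The form `c N ⊥ d N` acts on `A ⊗ F² ⊗ F²`: the first summand by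
left multiplications and the second by right multiplications. -/
theorem hasSpinor_smul_prod_smul {A : Type u} [Ring A] [Algebra F A] [FiniteDimensional F A]
    [StarRing A] (hs : ∀ (r : F) (v : A), star (r • v) = r • star v) (h4 : finrank F A = 4)
    (N : QuadraticForm F A) (hN : ∀ v, v * star v = N v • (1 : A))
    (hN' : ∀ v, star v * v = N v • (1 : A)) (c d : F) :
    HasSpinor ((c • N).prod (d • N)) := by
  let E : A →ₗ[F] End F ((A × A) × (A × A)) :=
    LinearMap.mk₂ F (fun v X => ((c • (v * X.1.2), star v * X.1.1),
        (c • (v * X.2.2), star v * X.2.1)))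
      (fun v w X => by ext1 <;> ext1 <;> simp [add_mul])
      (fun r v X => by ext1 <;> ext1 <;> simp [smul_comm c r, hs])
      (fun v X Y => by ext1 <;> ext1 <;> simp [mul_add])
      (fun r v X => by ext1 <;> ext1 <;> simp [smul_comm c r])
  let G : A →ₗ[F] End F ((A × A) × (A × A)) :=
    LinearMap.mk₂ F (fun v X => ((d • (X.2.1 * v), d • (X.2.2 * v)),
        (X.1.1 * star v, X.1.2 * star v)))
      (fun v w X => by ext1 <;> ext1 <;> simp [mul_add])
      (fun r v X => by ext1 <;> ext1 <;> simp [smul_comm d r, hs])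
      (fun v X Y => by ext1 <;> ext1 <;> simp [add_mul])
      (fun r v X => by ext1 <;> ext1 <;> simp [smul_comm d r])
  refine ⟨(A × A) × (A × A), inferInstance, inferInstance, inferInstance, LinearMap.coprod E G,
    ?_, ?_⟩
  · rintro ⟨v, w⟩
    have hE : E v * E v = (c * N v) • 1 := by
      refine LinearMap.ext fun X => ?_
      ext1 <;> ext1 <;> simp [E, ← mul_assoc, hN, hN', mul_smul]
    have hG : G w * G w = (d * N w) • 1 := by
      refine LinearMap.ext fun X => ?_
      ext1 <;> ext1 <;> simp [G, mul_assoc, hN, hN', mul_smul]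
    have hEG : E v * G w = G w * E v := by
      refine LinearMap.ext fun X => ?_
      ext1 <;> ext1 <;> simp [E, G, mul_assoc, smul_comm c d]
    have h2 : G w * E v + G w * E v = 0 := by
      rw [← two_smul F, CharTwo.two_eq_zero, zero_smul]
    change (E v + G w) * (E v + G w) = (c * N v + d * N w) • 1
    rw [add_smul, ← hE, ← hG, add_mul, mul_add, mul_add, hEG,
      add_assoc, ← add_assoc (G w * E v), h2, zero_add]
  · simp [h4]

theorem hasSpinor_scale_pfister_three (c a b : Fˣ) (x : F) :
    HasSpinor (scale c (pfister [a, b] x)).form := by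
  have hN := (CharTwoQuaternion.normForm_isometric x b)
  obtain ⟨e⟩ := (scale_orth c (pfister [b] x) (scale a (pfister [b] x))).trans
    (orth_congr (scale_congr c hN.symm)
      ((scale_scale c a (pfister [b] x)).trans (scale_congr (c * a) hN.symm)))
  have hm (v : CharTwoQuaternion x b) :
      v * star v = CharTwoQuaternion.normMap x b v • (1 : CharTwoQuaternion x b) := by
    rw [← CharTwoQuaternion.coe_normMap, Algebra.algebraMap_eq_smul_one]
  exact (hasSpinor_smul_prod_smul (fun r v => QuaternionAlgebra.star_smul r v)
    (QuaternionAlgebra.finrank_eq_four _ _ _) (CharTwoQuaternion.normMap x b) hm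
    (fun v => (star_comm_self' v).trans (hm v)) (c : F) ((c * a : Fˣ) : F)).congr e.symm

theorem power_three_le_spinorial : power F 3 ≤ spinorial F := by
  rw [power, AddSubgroup.closure_le]
  rintro _ ⟨c, q, ⟨l, x, hl, h⟩, rfl⟩
  obtain ⟨a, b, rfl⟩ : ∃ a b, l = [a, b] := by
    match l, hl with
    | [a, b], _ => exact ⟨a, b, rfl⟩
  obtain ⟨e⟩ := scale_congr c h.symm
  exact mk_mem_spinorial.2 ((hasSpinor_scale_pfister_three c a b x).congr e)

end QuadraticWittGroup

/-! ### Idempotents and ranks -/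

/-- If `g R g⁻¹ = 1 - R` for an invertible `g`, the idempotent `R` cuts in half every idempotent
`P` commuting with `R` and `g`. -/
theorem Module.End.finrank_range_eq_two_mul {F M : Type*} [Field F] [AddCommGroup M] [Module F M]
    [FiniteDimensional F M] {P R g : Module.End F M} (hR : R * R = R)
    (hPR : Commute P R) (hPg : Commute P g) {b : F} (hb : b ≠ 0) (hg : g * g = b • 1)
    (hgR : g * R = (1 - R) * g) :
    Module.finrank F (LinearMap.range P) = 2 * Module.finrank F (LinearMap.range (R * P)) := by
  have hinj : Function.Injective g := fun x y hxy => by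
    have h1 := LinearMap.congr_fun hg x
    have h2 := LinearMap.congr_fun hg y
    simp only [Module.End.mul_apply, LinearMap.smul_apply, Module.End.one_apply] at h1 h2
    rw [hxy] at h1
    exact smul_right_injective M hb (h1.symm.trans h2)
  have hsurj : Function.Surjective g := LinearMap.injective_iff_surjective.1 hinj
  have hmap : (LinearMap.range (R * P)).map g = LinearMap.range ((1 - R) * P) := by
    have h1 : g * (R * P) = ((1 - R) * P) * g := by
      rw [← mul_assoc, hgR, mul_assoc, mul_assoc, hPg.eq]
    rw [← LinearMap.range_comp, ← Module.End.mul_eq_comp, h1, Module.End.mul_eq_comp,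
      LinearMap.range_comp_of_range_eq_top _ (LinearMap.range_eq_top.2 hsurj)]
  have hdim : Module.finrank F (LinearMap.range ((1 - R) * P)) =
      Module.finrank F (LinearMap.range (R * P)) := by
    rw [← hmap]
    exact (Submodule.equivMapOfInjective g hinj _).finrank_eq.symm
  have hsup : LinearMap.range (R * P) ⊔ LinearMap.range ((1 - R) * P) = LinearMap.range P := by
    apply le_antisymm
    · refine sup_le ?_ ?_
      · rw [← hPR.eq]
        exact LinearMap.range_comp_le_range _ _
      · rw [← ((Commute.one_right P).sub_right hPR).eq]
        exact LinearMap.range_comp_le_range _ _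
    · rintro _ ⟨x, rfl⟩
      refine Submodule.mem_sup.2 ⟨_, ⟨x, rfl⟩, _, ⟨x, rfl⟩, ?_⟩
      simp
  have hinf : LinearMap.range (R * P) ⊓ LinearMap.range ((1 - R) * P) = ⊥ := by
    rw [eq_bot_iff]
    rintro _ ⟨⟨x, rfl⟩, ⟨y, hy⟩⟩
    have h1 : R ((R * P) x) = (R * P) x := LinearMap.congr_fun hR (P x)
    have h2 : R (((1 - R) * P) y) = 0 := by
      have : R * (1 - R) = 0 := by rw [mul_sub, mul_one, hR, sub_self]
      exact LinearMap.congr_fun this (P y)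
    rw [Submodule.mem_bot, ← h1, ← hy, h2]
  have := Submodule.finrank_sup_add_finrank_inf_eq (LinearMap.range (R * P))
    (LinearMap.range ((1 - R) * P))
  rw [hsup, hinf, finrank_bot, hdim] at this
  omega

/-! ### Quaternion algebras in characteristic two -/

namespace CharTwoQuaternion

open Module QuadraticForm

variable {F : Type u} [Field F] [CharP F 2]

theorem mul_star_eq (a : F) (b : Fˣ) (v : CharTwoQuaternion a b) :
    v * star v = normMap a b v • (1 : CharTwoQuaternion a b) := by
  rw [← coe_normMap, Algebra.algebraMap_eq_smul_one]

theorem star_mul_eq (a : F) (b : Fˣ) (v : CharTwoQuaternion a b) :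
    star v * v = normMap a b v • (1 : CharTwoQuaternion a b) :=
  (star_comm_self' v).trans (mul_star_eq a b v)

/-- Every quaternion satisfies its characteristic equation `v² = (tr v) v + N(v)`. -/
theorem mul_self_eq (a : F) (b : Fˣ) (v : CharTwoQuaternion a b) :
    v * v = v.imI • v + normMap a b v • (1 : CharTwoQuaternion a b) := by
  have h : (2 : F) = 0 := CharTwo.two_eq_zero
  rw [Algebra.smul_def (normMap a b v), normMap_apply]
  ext
  · simp [QuaternionAlgebra.algebraMap_eq]
    linear_combination (-(v.re * v.imI) - a * b * v.imK ^ 2) * h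
  · simp [QuaternionAlgebra.algebraMap_eq]
    linear_combination (v.re * v.imI) * h
  · simp [QuaternionAlgebra.algebraMap_eq]
    linear_combination (v.re * v.imJ) * h
  · simp [QuaternionAlgebra.algebraMap_eq]
    linear_combination (v.re * v.imK) * h

/-- With `y = ⟨0, 0, 1, 0⟩` and `z = t + u x`, the element `(y z + z y) y` is the scalar `b u`. -/
theorem eq_zero_of_map_mk_eq_zero {a : F} {b : Fˣ} {R : Type*} [Ring R] [Algebra F R]
    [Nontrivial R] (Θ : CharTwoQuaternion a b →ₐ[F] R) (t u : F)
    (h : Θ ⟨t, u, 0, 0⟩ = 0) : t = 0 ∧ u = 0 := by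
  have hc (r : F) (hr : Θ ⟨r, 0, 0, 0⟩ = 0) : r = 0 := by
    have : Θ (algebraMap F _ r) = 0 := hr
    rw [AlgHom.commutes] at this
    exact (map_eq_zero_iff _ (algebraMap F R).injective).1 this
  have h2 : (2 : F) = 0 := CharTwo.two_eq_zero
  let y : CharTwoQuaternion a b := ⟨0, 0, 1, 0⟩
  have hu : u = 0 := by
    have h1 : (y * ⟨t, u, 0, 0⟩ + ⟨t, u, 0, 0⟩ * y) * y =
        (⟨b * u, 0, 0, 0⟩ : CharTwoQuaternion a b) := by
      ext <;> simp [y]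
      linear_combination t * h2
    have h3 : Θ ⟨b * u, 0, 0, 0⟩ = 0 := by
      rw [← h1, map_mul, map_add, map_mul, map_mul, h]
      simp
    simpa using hc _ h3
  subst hu
  exact ⟨hc t h, rfl⟩

/-- The quaternion algebra is simple: its representations are faithful. If
`v = r + s x + t y + u x y` is in the kernel, so is `(x v + v x) y = b t + b u x`. -/
theorem algHom_injective {a : F} {b : Fˣ} {R : Type*} [Ring R] [Algebra F R]
    [Nontrivial R] (Θ : CharTwoQuaternion a b →ₐ[F] R) : Function.Injective Θ := by
  rw [injective_iff_map_eq_zero]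
  intro v hv
  have h2 : (2 : F) = 0 := CharTwo.two_eq_zero
  let x : CharTwoQuaternion a b := ⟨0, 1, 0, 0⟩
  let y : CharTwoQuaternion a b := ⟨0, 0, 1, 0⟩
  have h1 : (x * v + v * x) * y = (⟨b * v.imJ, b * v.imK, 0, 0⟩ : CharTwoQuaternion a b) := by
    ext <;> simp [x, y]
    · linear_combination (a * v.imI) * h2
    · linear_combination (v.re + v.imI) * h2
  have h3 : Θ ⟨b * v.imJ, b * v.imK, 0, 0⟩ = 0 := by
    rw [← h1, map_mul, map_add, map_mul, map_mul, hv]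
    simp
  obtain ⟨hj, hk⟩ := eq_zero_of_map_mk_eq_zero Θ _ _ h3
  have hj : v.imJ = 0 := by simpa using hj
  have hk : v.imK = 0 := by simpa using hk
  have hv' : v = ⟨v.re, v.imI, 0, 0⟩ := by ext <;> simp [hj, hk]
  rw [hv'] at hv
  obtain ⟨hr, hi⟩ := eq_zero_of_map_mk_eq_zero Θ _ _ hv
  rw [hv', hr, hi]
  rfl

/-- An isotropic norm form is hyperbolic: a norm equation `N(r, s) = b N(t, u)` makes `b` a
similarity factor of `[1, a]`. -/
theorem mk_normForm_eq_zero {a : F} {b : Fˣ} {v : CharTwoQuaternion a b} (hv : v ≠ 0)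
    (h : normMap a b v = 0) : QuadraticWittGroup.mk (normForm a b) = 0 := by
  rw [QuadraticWittGroup.mk_eq_of_isometric (normForm_isometric a b),
    QuadraticWittGroup.mk_pfister_two]
  -- A nontrivial zero of `[1, a]` makes `a` of the form `u ^ 2 + u`.
  have key (r s : F) (h0 : r ^ 2 + r * s + a * s ^ 2 = 0) (c : Fˣ) :
      (r = 0 ∧ s = 0) ∨ QuadraticWittGroup.binaryClass c a = 0 := by
    by_cases hs : s = 0
    · left
      subst hs
      exact ⟨by simpa using h0, rfl⟩
    · right
      have : a = (r / s) ^ 2 + r / s := by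
        have h2 : (2 : F) = 0 := CharTwo.two_eq_zero
        field_simp
        linear_combination h0 - (r ^ 2 + r * s) * h2
      rw [this, QuadraticWittGroup.binaryClass_sq_add]
  rw [normMap_apply, CharTwo.add_eq_zero] at h
  by_cases h2 : v.imJ ^ 2 + v.imJ * v.imK + a * v.imK ^ 2 = 0
  · rw [h2, mul_zero] at h
    have hD (c : Fˣ) : QuadraticWittGroup.binaryClass c a = 0 := by
      obtain ⟨h3, h4⟩ | h3 := key _ _ h c
      · obtain ⟨h5, h6⟩ | h5 := key _ _ h2 c
        · exact absurd (by ext <;> simp [h3, h4, h5, h6]) hv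
        · exact h5
      · exact h3
    rw [hD, hD, add_zero]
  · let n := Units.mk0 _ h2
    have h1 := QuadraticWittGroup.binaryClass_mul b n a _ _ rfl
    have h3 := QuadraticWittGroup.binaryClass_mul 1 (b * n) a v.re v.imI h.symm
    rw [← h1, ← h3, one_mul, QuadraticWittGroup.add_self]

/-- Let `A` and `B` act on a four-dimensional space `W` by commuting operators. If both are
division algebras, `v w = t w` for a fixed `w ≠ 0` defines a bijection between `A` and `B`, which
preserves norms. If one is not a division algebra, neither is the other, and both norm forms
are hyperbolic. -/
theorem mk_normForm_eq_of_commute {a c : F} {b d : Fˣ} {W : Type u} [AddCommGroup W] [Module F W]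
    [FiniteDimensional F W] (hW : finrank F W = 4) (Θ : CharTwoQuaternion a b →ₐ[F] End F W)
    (Ψ : CharTwoQuaternion c d →ₐ[F] End F W) (hc : ∀ v t, Commute (Θ v) (Ψ t)) :
    QuadraticWittGroup.mk (normForm a b) = QuadraticWittGroup.mk (normForm c d) := by
  have hnt : Nontrivial W := Module.nontrivial_of_finrank_pos (R := F) (by omega)
  obtain ⟨w, hw⟩ := exists_ne (0 : W)
  have bij {a : F} {b : Fˣ} (Θ : CharTwoQuaternion a b →ₐ[F] End F W)
      (ha : ∀ v, normMap a b v = 0 → v = 0) {w : W} (hw : w ≠ 0) :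
      Function.Bijective (LinearMap.applyₗ w ∘ₗ Θ.toLinearMap) := by
    have hinj : Function.Injective (LinearMap.applyₗ w ∘ₗ Θ.toLinearMap) := by
      rw [injective_iff_map_eq_zero]
      intro v hv
      have hv : Θ v w = 0 := hv
      refine ha v ?_
      have h1 := congrArg (fun z => Θ z w) (star_mul_eq a b v)
      simp only [map_mul, map_smul, map_one, Module.End.mul_apply, hv, map_zero,
        LinearMap.smul_apply, Module.End.one_apply] at h1
      exact (smul_eq_zero.1 h1.symm).resolve_right hw
    refine ⟨hinj, (LinearMap.injective_iff_surjective_of_finrank_eq_finrank ?_).1 hinj⟩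
    rw [hW, QuaternionAlgebra.finrank_eq_four]
  -- If `B` is a division algebra, `W` is a simple `B`-module, so `v` acts as zero or injectively.
  have mixed {a c : F} {b d : Fˣ} (Θ : CharTwoQuaternion a b →ₐ[F] End F W)
      (Ψ : CharTwoQuaternion c d →ₐ[F] End F W) (hc : ∀ v t, Commute (Θ v) (Ψ t))
      (hB : ∀ t, normMap c d t = 0 → t = 0) (v : CharTwoQuaternion a b)
      (hv : normMap a b v = 0) : v = 0 := by
    have hz (z : CharTwoQuaternion a b) (w : W) (hw : w ≠ 0) (h : Θ z w = 0) : z = 0 := by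
      apply algHom_injective Θ
      rw [map_zero]
      refine LinearMap.ext fun m => ?_
      obtain ⟨t, rfl⟩ := (bij Ψ hB hw).2 m
      have := LinearMap.congr_fun (hc z t).eq w
      simpa [h] using this
    have h1 : Θ v (Θ (star v) w) = 0 := by
      have := congrArg (fun z => Θ z w) (mul_star_eq a b v)
      simpa [hv] using this
    by_cases h2 : Θ (star v) w = 0
    · simpa using hz _ w hw h2
    · exact hz _ _ h2 h1
  by_cases hA : ∀ v, normMap a b v = 0 → v = 0
  · by_cases hB : ∀ t, normMap c d t = 0 → t = 0
    · let e₁ := LinearEquiv.ofBijective _ (bij Θ hA hw)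
      let e₂ := LinearEquiv.ofBijective _ (bij Ψ hB hw)
      have key (v t) (h : Θ v w = Ψ t w) : normMap c d t = normMap a b v := by
        have h1 : Θ (v * v) w = Ψ (t * t) w := by
          rw [map_mul, map_mul, Module.End.mul_apply, Module.End.mul_apply, h]
          have := LinearMap.congr_fun (hc v t).eq w
          simp only [Module.End.mul_apply] at this
          rw [this, h]
        rw [mul_self_eq, mul_self_eq] at h1
        simp only [map_add, map_smul, map_one, LinearMap.add_apply, LinearMap.smul_apply,
          Module.End.one_apply, ← h] at h1
        have h2 : (v.imI - t.imI) • Θ v w = (normMap c d t - normMap a b v) • w := by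
          rw [sub_smul, sub_smul, sub_eq_sub_iff_add_eq_add, h1, add_comm]
        by_cases htr : v.imI = t.imI
        · rw [htr, sub_self, zero_smul] at h2
          exact sub_eq_zero.1 ((smul_eq_zero.1 h2.symm).resolve_right hw)
        · -- If the traces differ, `v` and `t` act on `w` as scalars, hence are scalars themselves.
          exfalso
          obtain ⟨μ, hμ⟩ : ∃ μ : F, Θ v w = μ • w :=
            ⟨(v.imI - t.imI)⁻¹ * (normMap c d t - normMap a b v), by
              rw [mul_smul, ← h2, inv_smul_smul₀ (sub_ne_zero.2 htr)]⟩
          have hv : v = algebraMap F _ μ := (bij Θ hA hw).1 (by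
            change Θ v w = Θ (algebraMap F _ μ) w
            rw [AlgHom.commutes, hμ]; rfl)
          have ht : t = algebraMap F _ μ := (bij Ψ hB hw).1 (by
            change Ψ t w = Ψ (algebraMap F _ μ) w
            rw [AlgHom.commutes, ← h, hμ]; rfl)
          apply htr
          rw [hv, ht]
          rfl
      refine QuadraticWittGroup.mk_eq_of_isometric ⟨⟨e₁.trans e₂.symm, fun v => ?_⟩⟩
      refine key v (e₂.symm (e₁ v)) ?_
      exact (e₂.apply_symm_apply (e₁ v)).symm
    · exact absurd (mixed Ψ Θ (fun t v => (hc v t).symm) hA) hB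
  · by_cases hB : ∀ t, normMap c d t = 0 → t = 0
    · exact absurd (mixed Θ Ψ hc hB) hA
    · push Not at hA hB
      obtain ⟨v, hv, hv0⟩ := hA
      obtain ⟨t, ht, ht0⟩ := hB
      rw [mk_normForm_eq_zero hv0 hv, mk_normForm_eq_zero ht0 ht]

end CharTwoQuaternion

/-! ### Quaternion algebras acting on Clifford modules -/

namespace CharTwoQuaternion

open Module QuadraticForm

variable {F : Type u} [Field F] [CharP F 2]

/-- Let `e, f, g, h` be the operators of `1, x, y, x y` on a Clifford module of the norm form of
`[a, b)`. Then `e f` and `e g` satisfy the relations of the generators `x` and `y`. The idempotent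
`p = e f + b⁻¹ g h`, which comes from the centre of the even Clifford algebra, commutes with them,
as does `g`, and `g` exchanges `p` and `1 - p`. Whatever commutes with the Clifford action
commutes with all of these. -/
theorem exists_algHom_of_isCliffordAction {a : F} {b : Fˣ} {M : Type u} [AddCommGroup M]
    [Module F M] {ρ : CharTwoQuaternion a b →ₗ[F] End F M}
    (hρ : IsCliffordAction (normMap a b) ρ) :
    ∃ (Θ : CharTwoQuaternion a b →ₐ[F] End F M) (p g : End F M),
      p * p = p ∧ g * g = (b : F) • 1 ∧ g * p = (1 - p) * g ∧ (∀ v, Commute p (Θ v)) ∧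
      ∀ T : End F M, (∀ v, Commute T (ρ v)) → (∀ v, Commute T (Θ v)) ∧ Commute T p ∧
        Commute T g := by
  have two (t : End F M) : t + t = 0 := by
    rw [← two_smul F, CharTwo.two_eq_zero, zero_smul]
  have neg (t : End F M) : -t = t := neg_eq_of_add_eq_zero_left (two t)
  let e := ρ ⟨1, 0, 0, 0⟩
  let f := ρ ⟨0, 1, 0, 0⟩
  let g := ρ ⟨0, 0, 1, 0⟩
  let h := ρ ⟨0, 0, 0, 1⟩
  have hee : e * e = 1 := (hρ _).trans (by simp [normMap_apply])
  have hff : f * f = a • 1 := (hρ _).trans (by simp [normMap_apply])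
  have hgg : g * g = (b : F) • 1 := (hρ _).trans (by simp [normMap_apply])
  have hhh : h * h = (b * a : F) • 1 := (hρ _).trans (by simp [normMap_apply])
  have hef : e * f + f * e = 1 := (hρ.mul_add_mul _ _).trans (by
    simp only [QuadraticMap.polar, normMap_apply, QuaternionAlgebra.mk_add_mk]
    rw [← one_smul F (1 : End F M), smul_smul]
    congr 1
    ring)
  have hgh : g * h + h * g = (b : F) • 1 :=
    (hρ.mul_add_mul _ _).trans (by
      simp only [QuadraticMap.polar, normMap_apply, QuaternionAlgebra.mk_add_mk]
      congr 1
      ring)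
  have heg : Commute e g := hρ.commute (by simp [QuadraticMap.polar, normMap_apply])
  have heh : Commute e h := hρ.commute (by simp [QuadraticMap.polar, normMap_apply])
  have hfg : Commute f g := hρ.commute (by simp [QuadraticMap.polar, normMap_apply])
  have hfh : Commute f h := hρ.commute (by simp [QuadraticMap.polar, normMap_apply])
  -- Applied to `e, f` and to `g, h`.
  have prod_sq (e f : End F M) (r s t : F) (h1 : e * e = s • 1) (h2 : f * f = t • 1)
      (h3 : e * f + f * e = r • 1) : (e * f) * (e * f) = r • (e * f) + (s * t) • 1 := by
    have h4 : f * e = r • 1 - e * f := by rw [← h3]; abel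
    calc (e * f) * (e * f) = e * (f * e) * f := by noncomm_ring
      _ = r • (e * f) - (e * e) * (f * f) := by
        rw [h4, mul_sub, sub_mul, mul_smul_comm, mul_one, smul_mul_assoc]; noncomm_ring
      _ = _ := by
        rw [h1, h2, smul_mul_smul_comm, one_mul, sub_eq_add_neg, neg]
  have hxx : (e * f) * (e * f) = e * f + a • 1 := by
    have := prod_sq e f 1 1 a (by rw [hee, one_smul]) hff (by rw [hef, one_smul])
    rwa [one_smul, one_mul] at this
  have hfe : f * e = 1 - e * f := by rw [← hef]; abel
  have hhg : h * g = (b : F) • 1 - g * h := by rw [← hgh]; abel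
  let B : QuaternionAlgebra.Basis (End F M) a 1 (b : F) :=
    { i := e * f
      j := e * g
      k := (e * f) * (e * g)
      i_mul_i := by rw [hxx, one_smul, add_comm]
      j_mul_j := by
        rw [← hgg, ← one_mul (g * g), ← hee, mul_assoc, ← mul_assoc g, ← heg.eq]
        noncomm_ring
      i_mul_j := rfl
      j_mul_i := by
        have h1 : (e * g) * (e * f) = g * f := by
          rw [heg.eq, mul_assoc, ← mul_assoc e, hee, one_mul]
        have h2 : (e * f) * (e * g) = e * g - f * g := by
          calc (e * f) * (e * g) = e * (f * e) * g := by noncomm_ring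
            _ = e * g - (e * e) * (f * g) := by rw [hfe]; noncomm_ring
            _ = _ := by rw [hee, one_mul]
        rw [h1, h2, one_smul, ← hfg.eq, sub_sub_cancel] }
  have hΘ (T : End F M) (h1 : Commute T (e * f)) (h2 : Commute T (e * g)) (v) :
      Commute T (B.liftHom v) := by
    change Commute T (algebraMap F _ v.re + v.imI • (e * f) + v.imJ • (e * g) +
      v.imK • ((e * f) * (e * g)))
    exact ((Commute.add_right (Algebra.commutes v.re T).symm (h1.smul_right _)).add_right
      (h2.smul_right _)).add_right ((h1.mul_right h2).smul_right _)
  let x := e * f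
  let x' := (b : F)⁻¹ • (g * h)
  have hb : (b : F) ≠ 0 := b.ne_zero
  have hcom : Commute x x' :=
    (((heg.mul_left hfg).mul_right (heh.mul_left hfh))).smul_right _
  have hxx' : x' * x' = x' + a • 1 := by
    simp only [x']
    rw [smul_mul_smul_comm, prod_sq g h b b (b * a) hgg hhh hgh, smul_add, smul_smul, smul_smul]
    congr 2
    · field_simp
    · field_simp
  have hgx' : g * x' = h := by
    simp only [x']
    rw [mul_smul_comm, ← mul_assoc, hgg, smul_mul_assoc, one_mul, inv_smul_smul₀ hb]
  have hx'g : x' * g = g + h := by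
    simp only [x']
    rw [smul_mul_assoc, mul_assoc, hhg, mul_sub, mul_smul_comm, mul_one, smul_sub,
      inv_smul_smul₀ hb, ← mul_assoc, hgg, smul_mul_assoc, one_mul, inv_smul_smul₀ hb,
      sub_eq_add_neg, neg]
  have hgx : x * g = g * x := (heg.mul_left hfg).eq
  have hxe : x * e = e + e * x := by
    simp only [x]
    rw [mul_assoc, hfe, mul_sub, mul_one, sub_eq_add_neg, neg]
  refine ⟨B.liftHom, x + x', g, ?_, hgg, ?_, hΘ _ ?_ ?_, fun T hT => ⟨hΘ T ?_ ?_, ?_, hT _⟩⟩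
  · calc (x + x') * (x + x') = x * x + x' * x' + (x * x' + x' * x) := by noncomm_ring
      _ = (x + x') + (a • (1 : End F M) + a • 1) + (x' * x + x' * x) := by
        rw [hcom.eq, hxx', show x * x = x + a • 1 from hxx]; abel
      _ = x + x' := by rw [two, two, add_zero, add_zero]
  · rw [mul_add, hgx', sub_mul, one_mul, add_mul, hx'g, hgx, sub_eq_add_neg, neg]
    calc g * x + h = (g + g) + (g * x + h) := by rw [two, zero_add]
      _ = _ := by abel
  · exact (Commute.refl x).add_left hcom.symm
  · have h1 : x' * e = e * x' := ((heg.mul_right heh).smul_right _).eq.symm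
    change (x + x') * (e * g) = (e * g) * (x + x')
    calc (x + x') * (e * g) = (x * e) * g + (x' * e) * g := by noncomm_ring
      _ = e * g + e * (x * g) + e * (x' * g) := by rw [hxe, h1]; noncomm_ring
      _ = (e * g + e * g) + (e * (g * x) + e * h) := by rw [hx'g, hgx]; noncomm_ring
      _ = _ := by rw [two, zero_add, ← hgx']; noncomm_ring
  · exact (hT _).mul_right (hT _)
  · exact (hT _).mul_right (hT _)
  · exact ((hT _).mul_right (hT _)).add_right (((hT _).mul_right (hT _)).smul_right _)

/-- The representation of `A` on the range of an operator `P` that commutes with the action. -/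
def restrictRange {A M : Type*} [Ring A] [Algebra F A] [AddCommGroup M] [Module F M]
    (Θ : A →ₐ[F] End F M) (P : End F M) (h : ∀ v, Commute P (Θ v)) :
    A →ₐ[F] End F (LinearMap.range P) :=
  AlgHom.ofLinearMap
    { toFun := fun v => (Θ v).restrict (p := LinearMap.range P) (q := LinearMap.range P) (by
        rintro _ ⟨m, rfl⟩
        exact ⟨Θ v m, LinearMap.congr_fun (h v).eq m⟩)
      map_add' := fun v w => by ext x; simp [LinearMap.restrict_apply]
      map_smul' := fun r v => by ext x; simp [LinearMap.restrict_apply] }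
    (by ext x; simp [LinearMap.restrict_apply])
    (fun v w => by ext x; simp [LinearMap.restrict_apply])

/-- If the Clifford algebra of `N_A ⊥ N_B` is split, then the norm forms `N_A` and `N_B` are Witt
equivalent. On a spinor module, which has dimension 16, the idempotents of `A` and `B` cut out a
four-dimensional subspace on which `A` and `B` act by commuting operators. -/
theorem mk_normForm_eq_of_hasSpinor {a c : F} {b d : Fˣ}
    (h : HasSpinor ((normMap a b).prod (normMap c d))) :
    QuadraticWittGroup.mk (normForm a b) = QuadraticWittGroup.mk (normForm c d) := by
  obtain ⟨M, _, _, _, ρ, hρ, hd⟩ := h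
  have hM : finrank F M = 16 := by
    rw [finrank_prod, QuaternionAlgebra.finrank_eq_four, QuaternionAlgebra.finrank_eq_four] at hd
    exact Nat.pow_left_injective (n := 2) (by norm_num) hd
  obtain ⟨Θ, p, g, hp, hg, hgp, hpΘ, hT⟩ := exists_algHom_of_isCliffordAction hρ.inl
  obtain ⟨Ψ, p', g', hp', hg', hgp', hpΨ, hT'⟩ := exists_algHom_of_isCliffordAction hρ.inr
  have h1 (v) := hT' _ (fun t => hρ.commute_inl_inr v t)
  have hΘ (t) := hT (Ψ t) (fun v => ((h1 v).1 t).symm)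
  have hp'Θ := hT p' (fun v => (h1 v).2.1.symm)
  have hg'Θ := hT g' (fun v => (h1 v).2.2.symm)
  have hdim := Module.End.finrank_range_eq_two_mul (P := 1) hp (Commute.one_left _)
    (Commute.one_left _) b.ne_zero hg hgp
  have hdim' := Module.End.finrank_range_eq_two_mul (P := p) hp' hp'Θ.2.1.symm
    hg'Θ.2.1.symm d.ne_zero hg' hgp'
  have hone : finrank F (LinearMap.range (1 : End F M)) = 16 := by
    rw [Module.End.one_eq_id, LinearMap.range_id, finrank_top, hM]
  rw [mul_one] at hdim
  have hPΘ (v) : Commute (p' * p) (Θ v) := (hp'Θ.1 v).mul_left (hpΘ v)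
  have hPΨ (t) : Commute (p' * p) (Ψ t) := (hpΨ t).mul_left (hΘ t).2.1.symm
  refine mk_normForm_eq_of_commute (W := LinearMap.range (p' * p)) (by omega)
    (restrictRange Θ _ hPΘ) (restrictRange Ψ _ hPΨ) fun v t => ?_
  ext x
  exact LinearMap.congr_fun ((hΘ t).1 v).eq.symm (x : M)

end CharTwoQuaternion

namespace QuadraticWittGroup

open NonsingularForm

variable {F : Type u} [Field F] [CharP F 2]

/-- A class modulo `I_q³ F` has at most one representing quadratic 2-fold Pfister form, up to Witt
equivalence. -/
theorem mk_eq_of_classMod_eq {p q : NonsingularForm F} (hp : IsPfister 2 p) (hq : IsPfister 2 q)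
    (h : classMod 2 p = classMod 2 q) : mk p = mk q := by
  have key (p : NonsingularForm F) (hp : IsPfister 2 p) :
      ∃ a b, mk p = mk (CharTwoQuaternion.normForm a b) := by
    obtain ⟨l, a, hl, h⟩ := hp
    match l, hl with
    | [b], _ =>
      exact ⟨a, b, mk_eq_of_isometric (h.trans (CharTwoQuaternion.normForm_isometric a b).symm)⟩
  obtain ⟨a, b, h1⟩ := key p hp
  obtain ⟨c, d, h2⟩ := key q hq
  rw [h1, h2]
  have h3 := power_three_le_spinorial (QuotientAddGroup.eq.1 h)
  rw [h1, h2, neg_eq, mk_add, mk_mem_spinorial] at h3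
  exact CharTwoQuaternion.mk_normForm_eq_of_hasSpinor h3

end QuadraticWittGroup

/-! ### The invariants of a tight family -/

namespace QuadraticWittGroup

open NonsingularForm

variable {F : Type u} [Field F] [CharP F 2]

theorem quotient_add_self (n : ℕ) (g : QuadraticWittGroup F ⧸ power F n) : g + g = 0 := by
  obtain ⟨x, rfl⟩ := QuotientAddGroup.mk_surjective g
  rw [← QuotientAddGroup.mk_add, add_self, QuotientAddGroup.mk_zero]

theorem classMod_congr {n : ℕ} {p q : NonsingularForm F} (h : mk p = mk q) :
    classMod n p = classMod n q :=
  congrArg (QuotientAddGroup.mk (s := power F (n + 1))) h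

section

variable {ι : Type}

/-- The Witt group has exponent two, so the group generated by a family consists of its
subset sums. -/
theorem mem_generated_range {n : ℕ} {Q : ι → NonsingularForm F}
    {g : QuadraticWittGroup F ⧸ power F (n + 1)} :
    g ∈ generated n (Set.range Q) ↔ ∃ T : Finset ι, ∑ i ∈ T, classMod n (Q i) = g := by
  classical
  constructor
  · intro hg
    have step (T : Finset ι) (i : ι) :
        ∃ T', ∑ j ∈ T', classMod n (Q j) = classMod n (Q i) + ∑ j ∈ T, classMod n (Q j) := by
      by_cases hi : i ∈ T
      · refine ⟨T.erase i, ?_⟩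
        rw [← Finset.add_sum_erase T _ hi, ← add_assoc, quotient_add_self, zero_add]
      · exact ⟨insert i T, Finset.sum_insert hi⟩
    rw [generated] at hg
    induction hg using AddSubgroup.closure_induction_left with
    | zero => exact ⟨∅, Finset.sum_empty⟩
    | add_left x hx y hy ih =>
      obtain ⟨_, ⟨i, rfl⟩, rfl⟩ := hx
      obtain ⟨T, rfl⟩ := ih
      exact step T i
    | neg_add_cancel x hx y hy ih =>
      obtain ⟨_, ⟨i, rfl⟩, rfl⟩ := hx
      obtain ⟨T, rfl⟩ := ih
      rw [neg_eq_of_add_eq_zero_left (quotient_add_self _ _)]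
      exact step T i
  · rintro ⟨T, rfl⟩
    exact AddSubgroup.sum_mem _ fun i _ =>
      AddSubgroup.subset_closure ⟨_, ⟨i, rfl⟩, rfl⟩

theorem isTight_range {n : ℕ} {Q : ι → NonsingularForm F} {R : Finset ι → NonsingularForm F}
    (hQ : ∀ i, IsPfister n (Q i))
    (hR : ∀ T, Represents n (R T) (∑ i ∈ T, classMod n (Q i))) :
    IsTight n (Set.range Q) := by
  refine ⟨by rintro _ ⟨i, rfl⟩; exact hQ i, fun g hg => ?_⟩
  obtain ⟨T, rfl⟩ := mem_generated_range.1 hg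
  exact ⟨R T, hR T⟩

/-- The invariant of a family can be computed from one choice `R` of representatives. -/
theorem isFamilySigma_two [Fintype ι] {Q : ι → NonsingularForm F} {R : Finset ι → NonsingularForm F}
    (hQ : ∀ i, IsPfister 2 (Q i))
    (hR : ∀ T, Represents 2 (R T) (∑ i ∈ T, classMod 2 (Q i))) :
    IsFamilySigma 2 Q (∑ T, mk (R T)) :=
  ⟨isTight_range hQ hR, fun _ hrep => Finset.sum_congr rfl fun T _ =>
    mk_eq_of_classMod_eq (hrep T).1 (hR T).1 ((hrep T).2.trans (hR T).2.symm)⟩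

/-- If the generated group has the maximal order, its elements correspond to the subsets of the
index set, and its invariant is that of the family. -/
theorem isSigma_two [Fintype ι] {Q : ι → NonsingularForm F} {R : Finset ι → NonsingularForm F}
    (hQ : ∀ i, IsPfister 2 (Q i))
    (hR : ∀ T, Represents 2 (R T) (∑ i ∈ T, classMod 2 (Q i)))
    (hcard : Nat.card (generated 2 (Set.range Q)) = 2 ^ Fintype.card ι) :
    IsSigma 2 (Set.range Q) (∑ T, mk (R T)) := by
  have hfin : Finite (generated 2 (Set.range Q)) :=
    Nat.finite_of_card_ne_zero (by rw [hcard]; positivity)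
  let s : Finset ι → generated 2 (Set.range Q) := fun T =>
    ⟨∑ i ∈ T, classMod 2 (Q i), mem_generated_range.2 ⟨T, rfl⟩⟩
  have hsurj : Function.Surjective s := fun ⟨g, hg⟩ => by
    obtain ⟨T, rfl⟩ := mem_generated_range.1 hg
    exact ⟨T, rfl⟩
  have hbij : Function.Bijective s :=
    hsurj.bijective_of_nat_card_le (by rw [hcard, Nat.card_eq_fintype_card, Fintype.card_finset])
  refine ⟨isTight_range hQ hR, hfin, fun rep hrep => ?_⟩
  rw [← finsum_comp_equiv (Equiv.ofBijective s hbij), finsum_eq_sum_of_fintype]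
  exact Finset.sum_congr rfl fun T _ => mk_eq_of_classMod_eq (hrep (s T)).1 (hR T).1
    ((hrep (s T)).2.trans (hR T).2.symm)

end

/-! ### Relations between quadratic 2-fold Pfister forms -/

theorem isPfister_two (b : Fˣ) (a : F) : IsPfister 2 (pfister [b] a) :=
  ⟨[b], a, rfl, Isometric.refl _⟩

theorem mk_pfister_add (b : Fˣ) (a a' : F) :
    mk (pfister [b] a) + mk (pfister [b] a') = mk (pfister [b] (a + a')) := by
  simp only [mk_pfister_two, ← binaryClass_add]
  abel

theorem classMod_pfister_add (b : Fˣ) (a a' : F) :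
    classMod 2 (pfister [b] a) + classMod 2 (pfister [b] a') =
      classMod 2 (pfister [b] (a + a')) :=
  congrArg _ (mk_pfister_add b a a')

/-- Modulo `I_q³ F` the slot `b` of `⟨⟨b, a]]` is multiplicative, the error being
`⟨⟨b, c, a]]`. -/
theorem classMod_pfister_mul (b c : Fˣ) (a : F) :
    classMod 2 (pfister [b] a) + classMod 2 (pfister [c] a) =
      classMod 2 (pfister [b * c] a) := by
  refine QuotientAddGroup.eq.2 (AddSubgroup.subset_closure
    ⟨1, pfister [b, c] a, ⟨_, _, rfl, Isometric.refl _⟩, ?_⟩)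
  change -(mk (pfister [b] a) + mk (pfister [c] a)) + mk (pfister [b * c] a) = _
  rw [mk_eq_of_isometric (scale_one _), mk_pfister_three, mk_pfister_two, mk_pfister_two,
    mk_pfister_two, neg_eq]
  calc _ = (binaryClass 1 a + binaryClass 1 a) +
        ((binaryClass 1 a + binaryClass c a) + (binaryClass b a + binaryClass (b * c) a)) := by
        abel
    _ = _ := by rw [add_self, zero_add]

theorem mk_pfister_mul_self (b n : Fˣ) :
    mk (pfister [b * n] (n : F)) = mk (pfister [b] (n : F)) := by
  rw [mk_pfister_two, mk_pfister_two, binaryClass_mul_self]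

theorem mk_pfister_sq (b : Fˣ) (a : F) : mk (pfister [b] (a ^ 2)) = mk (pfister [b] a) := by
  simp only [mk_pfister_two, binaryClass_sq]

theorem mk_pfister_mul_sq (b n : Fˣ) (a : F) :
    mk (pfister [b * n ^ 2] a) = mk (pfister [b] a) := by
  rw [mk_pfister_two, mk_pfister_two, binaryClass_mul_sq]

/-- If `b c a` is a square, then `b [1, a]` and `c [1, a]` are isometric, since `a` is a
similarity factor of `[1, a]`. -/
theorem binaryClass_eq_of_mul_eq_sq (b c : Fˣ) (a r : F) (h : (b : F) * a = c * r ^ 2) :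
    binaryClass b a = binaryClass c a := by
  by_cases ha : a = 0
  · rw [ha, binaryClass_zero, binaryClass_zero]
  · have hr : r ≠ 0 := by
      rintro rfl
      simp [ha] at h
    have h1 := binaryClass_mul_self b (Units.mk0 a ha)
    have h2 := binaryClass_mul_sq c (Units.mk0 r hr) a
    rw [show b * Units.mk0 a ha = c * Units.mk0 r hr ^ 2 from Units.ext (by simpa using h)] at h1
    exact h1.symm.trans h2

/-- With `ε = α² + β` and `δ = β + α⁴ β⁻¹ = ε² β⁻¹`, the forms `⟨⟨ε, δ]]` and `⟨⟨β, α]]` are Witt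
equivalent: `δ + ε = α² + α⁴ β⁻¹`, which is `ε β⁻¹` times a square. -/
theorem mk_pfister_eq (α : F) (β ε : Fˣ) (hε : (ε : F) = α ^ 2 + β) :
    mk (pfister [ε] ((β : F) + α ^ 4 * (β : F)⁻¹)) = mk (pfister [β] α) := by
  have h2 : (2 : F) = 0 := CharTwo.two_eq_zero
  have hβ : (β : F) ≠ 0 := β.ne_zero
  set δ : F := (β : F) + α ^ 4 * (β : F)⁻¹ with hδ
  have hsum : δ + ε = α ^ 2 + α ^ 4 * (β : F)⁻¹ := by
    rw [hδ, hε]; linear_combination (β : F) * h2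
  have h1 : binaryClass ε (δ + ε) = binaryClass β (δ + ε) := by
    refine binaryClass_eq_of_mul_eq_sq _ _ _ (ε * α * (β : F)⁻¹) ?_
    rw [hsum, hε]; field_simp; ring
  have h3 : binaryClass β (α ^ 4 * (β : F)⁻¹) = binaryClass 1 (α ^ 4 * (β : F)⁻¹) := by
    refine binaryClass_eq_of_mul_eq_sq _ _ _ (α ^ 2) ?_
    simp; field_simp
  have h4 : binaryClass ε δ = binaryClass ε (δ + ε) + binaryClass 1 (ε : F) := by
    rw [← binaryClass_mul_self 1 ε, one_mul, binaryClass_add, add_assoc, CharTwo.add_self_eq_zero,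
      add_zero]
  have h5 : binaryClass β (δ + ε) = binaryClass β α + binaryClass 1 (α ^ 4 * (β : F)⁻¹) := by
    rw [hsum, ← binaryClass_add, binaryClass_sq, h3]
  have h6 : δ + (α ^ 4 * (β : F)⁻¹ + ε) = α ^ 2 := by
    rw [hδ, hε]; linear_combination ((β : F) + α ^ 4 * (β : F)⁻¹) * h2
  rw [mk_pfister_two, mk_pfister_two, h4, h1, h5, ← binaryClass_sq 1 α, ← h6, ← binaryClass_add 1 δ,
    ← binaryClass_add 1 (α ^ 4 * (β : F)⁻¹) (ε : F)]
  abel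

end QuadraticWittGroup

open QuadraticWittGroup NonsingularForm in
theorem mainTheorem6 {F : Type u} [Field F] [CharP F 2] (α : F) (β γ : Fˣ)
    (h : (β : F) ≠ α ^ 2) (Q : Fin 3 → NonsingularForm F)
    (hQ : Q = ![
      CharTwoQuaternion.normForm ((β : F) + α ^ 4 * (β : F)⁻¹) γ,
      CharTwoQuaternion.normForm ((β : F) + α ^ 4 * (β : F)⁻¹)
        (γ * Units.mk0 (α ^ 2 + (β : F)) (CharTwo.sq_add_ne_zero h)),
      CharTwoQuaternion.normForm (α ^ 2 + (β : F)) γ]) :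
    QuadraticWittGroup.IsTight 2 (Set.range Q) ∧
    (Nat.card (QuadraticWittGroup.generated 2 (Set.range Q)) = 8 →
      QuadraticWittGroup.IsSigma 2 (Set.range Q)
        (QuadraticWittGroup.mk (NonsingularForm.pfister [γ, β] α))) ∧
    QuadraticWittGroup.IsFamilySigma 2 Q
      (QuadraticWittGroup.mk (NonsingularForm.pfister [γ, β] α)) := by
  let ε : Fˣ := Units.mk0 (α ^ 2 + (β : F)) (CharTwo.sq_add_ne_zero h)
  let δ : F := (β : F) + α ^ 4 * (β : F)⁻¹
  have hδ : mk (pfister [ε] δ) = mk (pfister [β] α) := mk_pfister_eq α β ε rfl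
  -- The class of `π = [ε, γ)`, since `ε = α² + β`.
  have hπ : mk (pfister [γ] (ε : F)) = mk (pfister [γ] α) + mk (pfister [β * γ] (β : F)) := by
    rw [mul_comm β γ, mk_pfister_mul_self, ← mk_pfister_sq γ α, mk_pfister_add]
    rfl
  have hiso : ∀ i, Isometric (Q i)
      (![pfister [γ] δ, pfister [γ * ε] δ, pfister [γ] (ε : F)] i) := by
    intro i
    rw [hQ]
    fin_cases i <;> exact CharTwoQuaternion.normForm_isometric _ _
  have hPf : ∀ i, IsPfister 2 (Q i) := by
    intro i
    have := hiso i
    fin_cases i <;> exact ⟨_, _, rfl, this⟩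
  have hclass (i) : classMod 2 (Q i) =
      classMod 2 (![pfister [γ] δ, pfister [γ * ε] δ, pfister [γ] (ε : F)] i) :=
    classMod_congr (mk_eq_of_isometric (hiso i))
  have h0 : classMod 2 (Q 0) = classMod 2 (pfister [γ] δ) := hclass 0
  have h1 : classMod 2 (Q 1) = classMod 2 (pfister [γ * ε] δ) := hclass 1
  have h2 : classMod 2 (Q 2) = classMod 2 (pfister [γ] (ε : F)) := hclass 2
  have h01 : classMod 2 (pfister [β] α) = classMod 2 (Q 0) + classMod 2 (Q 1) := by
    rw [h0, h1, classMod_pfister_mul]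
    refine classMod_congr ?_
    rw [← hδ, show γ * (γ * ε) = ε * γ ^ 2 by rw [sq, ← mul_assoc, mul_comm], mk_pfister_mul_sq]
  have h02 : classMod 2 (pfister [γ] (δ + ε)) = classMod 2 (Q 0) + classMod 2 (Q 2) := by
    rw [h0, h2, classMod_pfister_add]
  have h12 : classMod 2 (pfister [γ * ε] (δ + ε)) = classMod 2 (Q 1) + classMod 2 (Q 2) := by
    rw [h1, h2, ← classMod_pfister_add]
    exact congrArg _ (classMod_congr (mk_pfister_mul_self γ ε))
  have h012 : classMod 2 (pfister [β * γ] (α + β)) =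
      classMod 2 (Q 0) + classMod 2 (Q 1) + classMod 2 (Q 2) := by
    have : classMod 2 (Q 2) = classMod 2 (pfister [γ] α) + classMod 2 (pfister [β * γ] (β : F)) :=
      h2.trans (congrArg (QuotientAddGroup.mk (s := power F 3)) hπ)
    rw [← h01, this, ← add_assoc, classMod_pfister_mul, classMod_pfister_add]
  have hzero : mk (pfister [1] (0 : F)) = 0 := by
    rw [mk_pfister_two, binaryClass_zero, add_zero]
  -- A choice of representatives of the subset sums.
  let R : Finset (Fin 3) → NonsingularForm F := fun T =>
    if 0 ∈ T then
      if 1 ∈ T then if 2 ∈ T then pfister [β * γ] (α + β) else pfister [β] α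
      else if 2 ∈ T then pfister [γ] (δ + ε) else pfister [γ] δ
    else
      if 1 ∈ T then if 2 ∈ T then pfister [γ * ε] (δ + ε) else pfister [γ * ε] δ
      else if 2 ∈ T then pfister [γ] (ε : F) else pfister [1] 0
  have hR : ∀ T, Represents 2 (R T) (∑ i ∈ T, classMod 2 (Q i)) := by
    intro T
    have hs : ∑ i ∈ T, classMod 2 (Q i) =
        ((if 0 ∈ T then classMod 2 (Q 0) else 0) + if 1 ∈ T then classMod 2 (Q 1) else 0) +
          if 2 ∈ T then classMod 2 (Q 2) else 0 := by
      rw [← Fin.sum_univ_three (fun i => if i ∈ T then classMod 2 (Q i) else 0),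
        Finset.sum_ite_mem, Finset.univ_inter]
    rw [hs]
    refine ⟨?_, ?_⟩
    · dsimp only [R]
      split_ifs <;> exact isPfister_two _ _
    · dsimp only [R]
      split_ifs
      · exact h012
      · rw [add_zero]; exact h01
      · rw [add_zero]; exact h02
      · rw [add_zero, add_zero]; exact h0.symm
      · rw [zero_add]; exact h12
      · rw [zero_add, add_zero]; exact h1.symm
      · rw [zero_add, zero_add]; exact h2.symm
      · rw [zero_add, zero_add]; exact congrArg (QuotientAddGroup.mk (s := power F 3)) hzero
  have hsum : ∑ T, mk (R T) = mk (pfister [γ, β] α) := by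
    have huniv : (Finset.univ : Finset (Finset (Fin 3))) =
        {∅, {0}, {1}, {2}, {0, 1}, {0, 2}, {1, 2}, {0, 1, 2}} := by decide
    have hexp : ∑ T, mk (R T) = mk (pfister [1] 0) + (mk (pfister [γ] δ) +
        (mk (pfister [γ * ε] δ) + (mk (pfister [γ] (ε : F)) + (mk (pfister [β] α) +
        (mk (pfister [γ] (δ + ε)) + (mk (pfister [γ * ε] (δ + ε)) +
        mk (pfister [β * γ] (α + β)))))))) := by
      rw [huniv]
      repeat rw [Finset.sum_insert (by decide)]
      rw [Finset.sum_singleton]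
      rfl
    rw [hexp, hzero, ← mk_pfister_add γ δ, ← mk_pfister_add (γ * ε) δ,
      ← mk_pfister_add (β * γ),
      mk_pfister_mul_self, hπ, mk_pfister_three, mk_pfister_two γ α, mk_pfister_two β α,
      mk_pfister_two (β * γ) α, mul_comm γ β]
    have two := add_self (F := F)
    set x := mk (pfister [γ] δ)
    set y := mk (pfister [γ * ε] δ)
    set z := mk (pfister [β * γ] (β : F))
    calc _ = (binaryClass 1 α + binaryClass β α) +
          (binaryClass γ α + binaryClass (β * γ) α) + (x + x) + (y + y) + (z + z) + (z + z) +
          (binaryClass 1 α + binaryClass 1 α) + (binaryClass 1 α + binaryClass 1 α) +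
          (binaryClass γ α + binaryClass γ α) := by abel
      _ = _ := by simp only [two, add_zero]
  rw [← hsum]
  exact ⟨isTight_range hPf hR, fun hc => isSigma_two hPf hR (by simpa using hc),
    isFamilySigma_two hPf hR⟩
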